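/- Let $\mathbb{T}=\mathbb{R}/2\pi\mathbb{Z}$. Let $V:\mathbb{T}\to\mathbb{R}$ be real analytic and let $\omega\in\mathbb{R}$ be Diophantine, i.e. there are $c>0$, $\tau>1$ with $|\sin 2\pi k\omega|>c/|k|^{\tau}$ for all integers $k\neq 0$. For $\phi\in\mathbb{T}$ let $H_{V,\omega,\phi}$ be the operator $(H_{V,\omega,\phi}x)_n=x_{n+1}+x_{n-1}+V(2\pi\omega n+\phi)x_n$ on $\ell^2(\mathbb{Z})$, whose spectrum $\sigma(V,\omega)$ does not depend on $\phi$, and let $$k(E,V,\omega)=\lim_{N\to\infty}\frac{1}{2N+1}\#\{\text{eigenvalues}\le E\text{ of the restriction of }H_{V,\omega,\phi}\text{ to }[-N,N]\text{ with zero boundary conditions}\}$$ be its integrated density of states (for all $\phi$). Let $a\in\mathbb{R}$, and suppose that the Schrödinger cocycle $A_{a,V}(\theta)=\begin{pmatrix}a-V(\theta)&-1\\1&0\end{pmatrix}$ is analytically reducible to the identity, i.e. there is a real analytic $Z:\mathbb{T}\to SL(2,\mathbb{R})$ with $A_{a,V}(\theta)Z(\theta)=Z(\theta+2\pi\omega)$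 for all $\theta\in\mathbb{T}$. Then for a generic real analytic potential $W$ and all sufficiently small $|\beta|\neq0$, the spectrum $\sigma(V+\beta W,\omega)$ has an open gap with integrated density of states $k(a,V,\omega)$. Precisely: for every $\rho>0$, let $C^a_\rho(\mathbb{T},\mathbb{R})$ be the space of real analytic $W:\mathbb{T}\to\mathbb{R}$ having a bounded analytic extension to $|\operatorname{Im}\theta|<\rho$, with the norm $|W|_\rho=\sup_{|\operatorname{Im}\theta|<\rho}|W(\theta)|$. There is an open dense set $G\subset C^a_\rho(\mathbb{T},\mathbb{R})$ such that for every $W\in G$ there is $\beta_0>0$ such that for every real $\beta$ with $0<|\beta|<\beta_0$ there are $l<r$ in $\sigma(V+\beta W,\omega)$ with $(l,r)\cap\sigma(V+\beta W,\omega)=\emptyset$ and $k(E,V+\beta W,\omega)=k(a,V,\omega)$ for all $E\in(l,r)$. -/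

import Mathlib

open Filter Topology

noncomputable section

namespace QPSchrodinger

/-- The circle `𝕋 = ℝ / 2πℤ`. -/
abbrev Torus : Type := AddCircle (2 * Real.pi)

instance fact_two_pi_pos : Fact (0 < 2 * Real.pi) := ⟨Real.two_pi_pos⟩

/-- A function on the circle is real analytic if its `2π`-periodic lift to `ℝ` is. -/
def IsRealAnalytic (f : Torus → ℝ) : Prop :=
  AnalyticOnNhd ℝ (fun t : ℝ => f (t : Torus)) Set.univ

/-- The frequency `ω` is Diophantine: there are `c > 0` and `τ > 1` such that
`|sin (2 π k ω)| > c / |k| ^ τ` for every nonzero integer `k`. -/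
def IsDiophantine (ω : ℝ) : Prop :=
  ∃ c > (0 : ℝ), ∃ τ > (1 : ℝ), ∀ k : ℤ, k ≠ 0 →
    c / |(k : ℝ)| ^ τ < |Real.sin (2 * Real.pi * k * ω)|

/-! ### The operator and its spectrum -/

/-- The Hilbert space `ℓ²(ℤ)`. -/
abbrev EllTwo : Type := lp (fun _ : ℤ => ℂ) 2

/-- The value `V (2πωn + φ)` of the potential at the site `n`. -/
def site (V : C(Torus, ℝ)) (ω : ℝ) (φ : Torus) (n : ℤ) : ℝ :=
  V (((2 * Real.pi * ω * n : ℝ) : Torus) + φ)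

theorem memlp_comp_equiv (e : ℤ ≃ ℤ) (x : EllTwo) :
    Memℓp (fun n => x (e n)) (2 : ENNReal) := by
  have h2 : 0 < (2 : ENNReal).toReal := by norm_num
  refine memℓp_gen ?_
  exact (e.summable_iff (f := fun n => ‖x n‖ ^ (2 : ENNReal).toReal)).2
    ((lp.memℓp x).summable h2)

/-- The isometry `(x_n) ↦ (x_{e n})` of `ℓ²(ℤ)` given by a permutation `e` of `ℤ`. -/
def permute (e : ℤ ≃ ℤ) : EllTwo →L[ℂ] EllTwo :=
  LinearMap.mkContinuous
    { toFun := fun x => ⟨fun n => x (e n), memlp_comp_equiv e x⟩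
      map_add' := fun _ _ => rfl
      map_smul' := fun _ _ => rfl } 1 (by
    intro x
    have h2 : 0 < (2 : ENNReal).toReal := by norm_num
    rw [one_mul, lp.norm_eq_tsum_rpow h2, lp.norm_eq_tsum_rpow h2]
    exact le_of_eq (congrArg (fun s : ℝ => s ^ (1 / (2 : ENNReal).toReal))
      (e.tsum_eq (fun n => ‖x n‖ ^ (2 : ENNReal).toReal))))

theorem norm_site_le (V : C(Torus, ℝ)) (ω : ℝ) (φ : Torus) (n : ℤ) :
    ‖((site V ω φ n : ℝ) : ℂ) • ContinuousLinearMap.id ℂ ℂ‖ ≤ ‖V‖ := by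
  rw [norm_smul, ContinuousLinearMap.norm_id, mul_one, Complex.norm_real]
  exact V.norm_coe_le_norm _

/-- The quasi-periodic Schrödinger operator on `ℓ²(ℤ)`,
`(H x)_n = x_{n+1} + x_{n-1} + V (2πωn + φ) x_n`. -/
def schrodingerOp (V : C(Torus, ℝ)) (ω : ℝ) (φ : Torus) : EllTwo →L[ℂ] EllTwo :=
  permute (Equiv.addRight 1) + permute (Equiv.addRight (-1)) +
    lp.mapCLM 2 (fun n => ((site V ω φ n : ℝ) : ℂ) • ContinuousLinearMap.id ℂ ℂ)
      (norm_nonneg V) (norm_site_le V ω φ)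

theorem schrodingerOp_apply (V : C(Torus, ℝ)) (ω : ℝ) (φ : Torus) (x : EllTwo) (n : ℤ) :
    schrodingerOp V ω φ x n = x (n + 1) + x (n - 1) + (site V ω φ n : ℂ) * x n := rfl

/-- The spectrum of the (self-adjoint) operator `schrodingerOp V ω φ`, as a subset of `ℝ`. -/
def schrodingerSpectrum (V : C(Torus, ℝ)) (ω : ℝ) (φ : Torus) : Set ℝ :=
  {E : ℝ | (E : ℂ) ∈ spectrum ℂ (schrodingerOp V ω φ)}

/-- `(l, r)` is an open spectral gap: a nonempty bounded connected component of the
complement of the spectrum, the same for all phases `φ`. -/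
def IsOpenGap (V : C(Torus, ℝ)) (ω : ℝ) (l r : ℝ) : Prop :=
  l < r ∧ ∀ φ : Torus, l ∈ schrodingerSpectrum V ω φ ∧ r ∈ schrodingerSpectrum V ω φ ∧
    Disjoint (Set.Ioo l r) (schrodingerSpectrum V ω φ)

/-! ### The integrated density of states -/

/-- The restriction of the Schrödinger operator to `[-N, N]` with zero boundary conditions;
the index `i : Fin (2N+1)` stands for the site `i - N`. -/
def truncation (V : C(Torus, ℝ)) (ω : ℝ) (φ : Torus) (N : ℕ) :
    Matrix (Fin (2 * N + 1)) (Fin (2 * N + 1)) ℝ :=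
  Matrix.of fun i j =>
    if i = j then site V ω φ ((i : ℕ) - (N : ℤ))
    else if (i : ℕ) + 1 = j ∨ (j : ℕ) + 1 = i then 1 else 0

theorem truncation_isHermitian (V : C(Torus, ℝ)) (ω : ℝ) (φ : Torus) (N : ℕ) :
    (truncation V ω φ N).IsHermitian := by
  ext i j
  simp only [truncation, Matrix.conjTranspose_apply, Matrix.of_apply, star_trivial]
  by_cases h : i = j
  · subst h; rfl
  · rw [if_neg h, if_neg (Ne.symm h)]
    exact if_congr or_comm rfl rfl

/-- The proportion of the eigenvalues of the restriction to `[-N, N]` (counted with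
multiplicity) that are `≤ E`. -/
def idsApprox (V : C(Torus, ℝ)) (ω : ℝ) (φ : Torus) (E : ℝ) (N : ℕ) : ℝ :=
  ((Finset.univ.filter
    fun i => (truncation_isHermitian V ω φ N).eigenvalues i ≤ E).card : ℝ) / (2 * N + 1)

/-- `κ` is the integrated density of states `k(E, V, ω)`: for every phase `φ` it is the limit
of the eigenvalue counting proportions as `N → ∞`. -/
def HasIDS (V : C(Torus, ℝ)) (ω E κ : ℝ) : Prop :=
  ∀ φ : Torus, Tendsto (idsApprox V ω φ E) atTop (𝓝 κ)

/-! ### Cocycles and reducibility -/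

/-- The Schrödinger cocycle `A_{a,V}(θ)`, with rows `(a - V(θ), -1)` and `(1, 0)`. -/
def cocycle (a : ℝ) (V : C(Torus, ℝ)) (θ : Torus) : Matrix.SpecialLinearGroup (Fin 2) ℝ :=
  ⟨!![a - V θ, -1; 1, 0], by simp [Matrix.det_fin_two]⟩

/-- The cocycle `(A, ω)` is analytically reducible to constant coefficients with Floquet
matrix `B`: there is a real analytic `Z : 𝕋 → SL(2, ℝ)` with
`A(θ) Z(θ) = Z(θ + 2πω) B` for all `θ`. -/
def AnalyticallyReducibleTo (A : Torus → Matrix.SpecialLinearGroup (Fin 2) ℝ) (ω : ℝ)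
    (B : Matrix.SpecialLinearGroup (Fin 2) ℝ) : Prop :=
  ∃ Z : Torus → Matrix.SpecialLinearGroup (Fin 2) ℝ,
    (∀ i j, IsRealAnalytic fun θ => Z θ i j) ∧
    ∀ θ : Torus, A θ * Z θ = Z (θ + ((2 * Real.pi * ω : ℝ) : Torus)) * B

/-! ### The space of real analytic potentials -/

/-- The complex strip `|Im θ| < ρ`. -/
def strip (ρ : ℝ) : Set ℂ := {z | |z.im| < ρ}

/-- The space `C^a_ρ(𝕋, ℝ)` of real analytic potentials having a bounded analytic extension to
`|Im θ| < ρ`. A potential is represented by its (unique) extension, and the space carries the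
norm `|V|_ρ = sup_{|Im θ| < ρ} |V(θ)|` of bounded continuous functions on the strip. -/
def AnalyticPotential (ρ : ℝ) : Submodule ℝ (BoundedContinuousFunction (strip ρ) ℂ) where
  carrier := {f |
    (∃ F : ℂ → ℂ, DifferentiableOn ℂ F (strip ρ) ∧ ∀ z : strip ρ, F z = f z) ∧
    (∀ z w : strip ρ, (w : ℂ) = z + 2 * Real.pi → f w = f z) ∧
    ∀ z : strip ρ, (z : ℂ).im = 0 → (f z).im = 0}
  zero_mem' := ⟨⟨0, differentiableOn_const 0, fun _ => rfl⟩, fun _ _ _ => rfl, fun _ _ => rfl⟩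
  add_mem' := by
    rintro f g ⟨⟨F, hF, hFf⟩, hfp, hfr⟩ ⟨⟨G, hG, hGg⟩, hgp, hgr⟩
    refine ⟨⟨F + G, hF.add hG, fun z => ?_⟩, fun z w h => ?_, fun z h => ?_⟩
    · simp [hFf z, hGg z]
    · simp [hfp z w h, hgp z w h]
    · simp [hfr z h, hgr z h]
  smul_mem' := by
    rintro c f ⟨⟨F, hF, hFf⟩, hfp, hfr⟩
    refine ⟨⟨c • F, hF.const_smul c, fun z => ?_⟩, fun z w h => ?_, fun z h => ?_⟩
    · simp [hFf z]
    · simp [hfp z w h]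
    · simp [hfr z h]

/-- A real number as a point of the strip. -/
def realPoint {ρ : ℝ} (hρ : 0 < ρ) (t : ℝ) : strip ρ := ⟨(t : ℂ), by simpa [strip] using hρ⟩

theorem continuous_realPoint {ρ : ℝ} (hρ : 0 < ρ) : Continuous (realPoint hρ) :=
  Continuous.subtype_mk Complex.continuous_ofReal _

theorem AnalyticPotential.periodic {ρ : ℝ} (hρ : 0 < ρ) (W : AnalyticPotential ρ) :
    Function.Periodic (fun t : ℝ => (W.1 (realPoint hρ t)).re) (2 * Real.pi) := by
  intro t
  have h := W.2.2.1 (realPoint hρ t) (realPoint hρ (t + 2 * Real.pi)) (by simp [realPoint])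
  exact congrArg Complex.re h

/-- The potential `𝕋 → ℝ` given by an element of `C^a_ρ(𝕋, ℝ)`: its restriction to the
real axis. -/
def AnalyticPotential.toPotential {ρ : ℝ} (hρ : 0 < ρ) (W : AnalyticPotential ρ) :
    C(Torus, ℝ) where
  toFun := (AnalyticPotential.periodic hρ W).lift
  continuous_toFun := by
    refine continuous_coinduced_dom.mpr ?_
    exact Complex.continuous_re.comp (W.1.continuous.comp (continuous_realPoint hρ))

end QPSchrodinger

end

open QPSchrodinger

namespace QPSchrodinger

noncomputable section


/-! ### Jacobi matrices and eigenvalue counting -/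

/-! At the energy `a` all solutions are quasi-periodic: the first row of `Z` gives two of them, z₁
and z₂, with Wronskian one. For the potential V + sU and the energy a + sμ, variation of constants x
= y₁w₁ + y₂w₂ turns the equation into a slow system for w with generator s·g·((y₁y₂, y₂²), (-y₁²,
-y₁y₂)), where g = μ - U. Averaging along the rotation replaces this by a constant traceless matrix.
The choice of μ that makes the mean of g z₁² vanish leaves ((p, q), (0, -p)), which is hyperbolic
when p ≠ 0.

Hyperbolicity is exploited through a Lyapunov function, an indefinite quadratic form in w that grows
at each site by at least c x² - T((H - E)x)². For x in ℓ² the sum of the increments is zero, so H -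
E is bounded below, and by self-adjointness E = a + sμ is a resolvent energy
(`exists_boundedBelow_of_averages`). Averaging is needed only to a fixed accuracy, so trigonometric
approximation replaces the small divisor problem (`exists_approx_coboundary`), and the arithmetic of
ω enters only through irrationality.

Such an energy lies in a bounded gap because the form of H - a takes both signs: otherwise Sturm
oscillation would keep a solution positive, possibly after alternating signs, against recurrence
(`pos_of_jform_nonpos`). Both signs persist for small s.

The gap label is found by counting eigenvalues in finite windows. Counts are additive up to bounded
errors, so a density exists (`exists_hasIDS`). It is constant along a path of resolvent energies,
and its continuity as s → 0 identifies it with the value at `a` (`hasIDS_of_path_tendsto`).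

Finally, p ≠ 0 says that a continuous linear functional of W, the mean against a fixed density, does
not vanish. Analyticity and the Wronskian make this density nonzero
(`IsFloquetPair.density_ne_zero`), so the condition is open and dense. -/

/-- The action of the discrete Schrödinger operator with potential `v` on a real sequence. -/
def jop (v x : ℤ → ℝ) (i : ℤ) : ℝ := x (i + 1) + x (i - 1) + v i * x i

/-- The Jacobi matrix with potential `v` on the window `[p, p + n)`. -/
def jacobi (v : ℤ → ℝ) (p : ℤ) (n : ℕ) : Matrix (Fin n) (Fin n) ℝ :=
  Matrix.of fun i j =>
    if i = j then v (p + (i : ℕ)) else if (i : ℕ) + 1 = j ∨ (j : ℕ) + 1 = i then 1 else 0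

theorem jacobi_isHermitian (v : ℤ → ℝ) (p : ℤ) (n : ℕ) : (jacobi v p n).IsHermitian := by
  ext i j
  simp only [jacobi, Matrix.conjTranspose_apply, Matrix.of_apply, star_trivial]
  by_cases h : i = j
  · subst h; rfl
  · rw [if_neg h, if_neg (Ne.symm h)]
    exact if_congr or_comm rfl rfl

/-- The number of eigenvalues `≤ E` of the Jacobi matrix on `[p, p + n)`. -/
def cnt (v : ℤ → ℝ) (p : ℤ) (n : ℕ) (E : ℝ) : ℕ :=
  (Finset.univ.filter fun i => (jacobi_isHermitian v p n).eigenvalues i ≤ E).card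

theorem cnt_congr {v v' : ℤ → ℝ} {p p' : ℤ} {n : ℕ}
    (h : ∀ i : ℕ, i < n → v (p + i) = v' (p' + i)) (E : ℝ) : cnt v p n E = cnt v' p' n E := by
  have hJ : jacobi v p n = jacobi v' p' n := by
    ext i j
    simp only [jacobi, Matrix.of_apply, h i i.2]
  unfold cnt
  congr! 4

theorem cnt_le (v : ℤ → ℝ) (p : ℤ) (n : ℕ) (E : ℝ) : cnt v p n E ≤ n := by
  refine (Finset.card_filter_le _ _).trans ?_
  simp

theorem cnt_mono (v : ℤ → ℝ) (p : ℤ) (n : ℕ) {E E' : ℝ} (h : E ≤ E') :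
    cnt v p n E ≤ cnt v p n E' :=
  Finset.card_le_card fun i hi => by
    simp only [Finset.mem_filter] at hi ⊢
    exact ⟨hi.1, hi.2.trans h⟩

/-- Sequences supported in `[p, p + n)`. -/
def window (p : ℤ) (n : ℕ) : Submodule ℝ (ℤ → ℝ) where
  carrier := {x | ∀ i, i ∉ Finset.Ico p (p + n) → x i = 0}
  add_mem' := by
    intro x y hx hy i hi
    simp [hx i hi, hy i hi]
  zero_mem' := fun _ _ => rfl
  smul_mem' := by
    intro c x hx i hi
    simp [hx i hi]

/-- Restriction of sequences to a window. -/
def windowRestrict (p : ℤ) (n : ℕ) : window p n →ₗ[ℝ] (Fin n → ℝ) where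
  toFun x j := x.1 (p + (j : ℕ))
  map_add' _ _ := rfl
  map_smul' _ _ := rfl

theorem windowRestrict_injective (p : ℤ) (n : ℕ) :
    Function.Injective (windowRestrict p n) := by
  intro x y h
  ext i
  by_cases hi : i ∈ Finset.Ico p (p + n)
  · rw [Finset.mem_Ico] at hi
    have := congrFun h ⟨(i - p).toNat, by omega⟩
    simp only [windowRestrict, LinearMap.coe_mk, AddHom.coe_mk] at this
    rwa [show p + ((i - p).toNat : ℤ) = i by omega] at this
  · rw [x.2 i hi, y.2 i hi]

instance window_finiteDimensional (p : ℤ) (n : ℕ) : FiniteDimensional ℝ (window p n) :=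
  FiniteDimensional.of_injective _ (windowRestrict_injective p n)

theorem finrank_window_le (p : ℤ) (n : ℕ) : Module.finrank ℝ (window p n) ≤ n := by
  simpa using LinearMap.finrank_le_finrank_of_injective (windowRestrict_injective p n)

/-- The dimension count behind every min-max argument below: a test space where the form is small
and one where it is large meet only in zero. -/
theorem finrank_add_le_of_disjoint_window {p : ℤ} {n : ℕ} {X Y : Submodule ℝ (ℤ → ℝ)}
    (hX : X ≤ window p n) (hY : Y ≤ window p n) (h : ∀ x ∈ X, x ∈ Y → x = 0) :
    Module.finrank ℝ X + Module.finrank ℝ Y ≤ n := by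
  have fX : FiniteDimensional ℝ X := Submodule.finiteDimensional_of_le hX
  have fY : FiniteDimensional ℝ Y := Submodule.finiteDimensional_of_le hY
  have h0 : X ⊓ Y = ⊥ := by
    rw [eq_bot_iff]
    intro x hx
    exact h x hx.1 hx.2
  have h1 := Submodule.finrank_sup_add_finrank_inf_eq X Y
  rw [h0, finrank_bot, add_zero] at h1
  rw [← h1]
  exact (Submodule.finrank_mono (sup_le hX hY)).trans (finrank_window_le p n)

theorem finrank_le_inf_ker_add_one (X : Submodule ℝ (ℤ → ℝ)) [FiniteDimensional ℝ X] (i : ℤ) :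
    Module.finrank ℝ X ≤
      Module.finrank ℝ (X ⊓ LinearMap.ker (LinearMap.proj i : (ℤ → ℝ) →ₗ[ℝ] ℝ) :
        Submodule ℝ (ℤ → ℝ)) + 1 := by
  set f : X →ₗ[ℝ] ℝ := (LinearMap.proj i : (ℤ → ℝ) →ₗ[ℝ] ℝ).domRestrict X with hf
  have h1 := LinearMap.finrank_range_add_finrank_ker f
  have h2 : Module.finrank ℝ (LinearMap.range f) ≤ 1 := by
    simpa using Submodule.finrank_le (LinearMap.range f)
  have h3 : (LinearMap.ker f).map X.subtype =
      X ⊓ LinearMap.ker (LinearMap.proj i : (ℤ → ℝ) →ₗ[ℝ] ℝ) := by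
    ext x
    simp [hf, and_comm]
  have h4 : Module.finrank ℝ (LinearMap.ker f) = Module.finrank ℝ
      ((LinearMap.ker f).map X.subtype) :=
    (LinearEquiv.finrank_eq
      (Submodule.equivMapOfInjective X.subtype X.injective_subtype (LinearMap.ker f)))
  rw [← h3]
  omega

/-- Extension by zero of a vector indexed by a window. -/
def windowExtend (p : ℤ) (n : ℕ) : (Fin n → ℝ) →ₗ[ℝ] (ℤ → ℝ) where
  toFun y m := ∑ j : Fin n, if p + (j : ℕ) = m then y j else 0
  map_add' y z := by
    ext m
    simp only [Pi.add_apply, ← Finset.sum_add_distrib]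
    exact Finset.sum_congr rfl fun j _ => by split_ifs <;> simp
  map_smul' c y := by
    ext m
    simp only [Pi.smul_apply, smul_eq_mul, RingHom.id_apply, Finset.mul_sum]
    exact Finset.sum_congr rfl fun j _ => by split_ifs <;> simp

theorem windowExtend_apply (p : ℤ) (n : ℕ) (y : Fin n → ℝ) (m : ℤ) :
    windowExtend p n y m = ∑ j : Fin n, if p + (j : ℕ) = m then y j else 0 := rfl

theorem windowExtend_apply_add (p : ℤ) (n : ℕ) (y : Fin n → ℝ) (i : Fin n) :
    windowExtend p n y (p + (i : ℕ)) = y i := by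
  rw [windowExtend_apply, Finset.sum_eq_single i]
  · simp
  · intro j _ hj
    rw [if_neg]
    intro h
    exact hj (Fin.ext (by omega))
  · simp

theorem windowExtend_mem (p : ℤ) (n : ℕ) (y : Fin n → ℝ) : windowExtend p n y ∈ window p n := by
  intro i hi
  rw [windowExtend_apply]
  refine Finset.sum_eq_zero fun j _ => if_neg ?_
  intro h
  apply hi
  rw [Finset.mem_Ico]
  omega

theorem windowExtend_injective (p : ℤ) (n : ℕ) : Function.Injective (windowExtend p n) := by
  intro y z h
  ext i
  rw [← windowExtend_apply_add p n y i, h, windowExtend_apply_add]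

theorem sum_window (p : ℤ) (n : ℕ) (f : ℤ → ℝ) :
    ∑ i ∈ Finset.Ico p (p + n), f i = ∑ j : Fin n, f (p + (j : ℕ)) := by
  rw [Fin.sum_univ_eq_sum_range (fun j : ℕ => f (p + j)) n]
  refine (Finset.sum_nbij (fun j : ℕ => p + (j : ℤ)) ?_ ?_ ?_ ?_).symm
  · intro j hj
    simp only [Finset.mem_range, Finset.mem_Ico] at hj ⊢
    omega
  · intro i _ j _ h
    simpa using h
  · intro i hi
    simp only [Finset.coe_Ico, Set.mem_Ico] at hi
    exact ⟨(i - p).toNat, by simp; omega, by simp; omega⟩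
  · intro j _; rfl

theorem jacobi_mulVec (v : ℤ → ℝ) (p : ℤ) (n : ℕ) (y : Fin n → ℝ) (i : Fin n) :
    (jacobi v p n).mulVec y i = jop v (windowExtend p n y) (p + (i : ℕ)) := by
  have h : ∀ j : Fin n, jacobi v p n i j * y j =
      ((if p + (j : ℕ) = p + (i : ℕ) + 1 then y j else 0) +
        (if p + (j : ℕ) = p + (i : ℕ) - 1 then y j else 0)) +
        if i = j then v (p + (i : ℕ)) * y j else 0 := by
    intro j
    simp only [jacobi, Matrix.of_apply]
    by_cases h : i = j
    · subst h
      simp only [if_true]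
      rw [if_neg (by omega), if_neg (by omega)]
      ring
    · have h' : (i : ℕ) ≠ j := fun e => h (Fin.ext e)
      rw [if_neg h, if_neg h]
      by_cases h1 : (i : ℕ) + 1 = j
      · rw [if_pos (Or.inl h1), if_pos (by omega), if_neg (by omega)]; ring
      · by_cases h2 : (j : ℕ) + 1 = i
        · rw [if_pos (Or.inr h2), if_neg (by omega), if_pos (by omega)]; ring
        · rw [if_neg (by omega), if_neg (by omega), if_neg (by omega)]; ring
  rw [Matrix.mulVec, dotProduct, Finset.sum_congr rfl fun j _ => h j, Finset.sum_add_distrib,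
    Finset.sum_add_distrib, jop, windowExtend_apply_add, windowExtend_apply, windowExtend_apply]
  simp

/-- The space is spanned by the eigenvectors indexed by `S`, extended by zero, and `c` holds
eigenbasis coordinates. The residual is measured inside the window only; `jop` of the extension may
be nonzero at the two adjacent sites. -/
theorem exists_spectral_subspace (v : ℤ → ℝ) (p : ℤ) (n : ℕ) (S : Finset (Fin n)) :
    ∃ X : Submodule ℝ (ℤ → ℝ), X ≤ window p n ∧ Module.finrank ℝ X = S.card ∧
      ∀ x ∈ X, ∃ c : Fin n → ℝ, (∀ i, i ∉ S → c i = 0) ∧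
        (∑ i ∈ Finset.Ico p (p + n), x i ^ 2 = ∑ i, c i ^ 2) ∧
        (∑ i ∈ Finset.Ico p (p + n), x i * jop v x i =
          ∑ i, (jacobi_isHermitian v p n).eigenvalues i * c i ^ 2) ∧
        ∀ E : ℝ, ∑ i ∈ Finset.Ico p (p + n), (jop v x i - E * x i) ^ 2 =
          ∑ i, ((jacobi_isHermitian v p n).eigenvalues i - E) ^ 2 * c i ^ 2 := by
  set hA := jacobi_isHermitian v p n with hA'
  set b := hA.eigenvectorBasis with hb
  set e := hA.eigenvalues with he
  let B : EuclideanSpace ℝ (Fin n) →ₗ[ℝ] (ℤ → ℝ) :=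
    (windowExtend p n) ∘ₗ (WithLp.linearEquiv 2 ℝ (Fin n → ℝ)).toLinearMap
  have hBinj : Function.Injective B :=
    (windowExtend_injective p n).comp (WithLp.linearEquiv 2 ℝ (Fin n → ℝ)).injective
  let X0 : Submodule ℝ (EuclideanSpace ℝ (Fin n)) := Submodule.span ℝ (Set.range fun i : S => b i)
  have hli : LinearIndependent ℝ (fun i : S => b i) :=
    b.orthonormal.linearIndependent.comp _ Subtype.val_injective
  refine ⟨X0.map B, ?_, ?_, ?_⟩
  · rintro _ ⟨y, -, rfl⟩
    exact windowExtend_mem p n _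
  · rw [← LinearEquiv.finrank_eq (Submodule.equivMapOfInjective B hBinj X0),
      finrank_span_eq_card hli]
    simp
  · rintro _ ⟨y, hy, rfl⟩
    have hnorm : ∀ z : EuclideanSpace ℝ (Fin n), ∑ i, (z i) ^ 2 = ∑ i, (inner ℝ (b i) z) ^ 2 := by
      intro z
      have h1 := EuclideanSpace.real_norm_sq_eq z
      have h2 := b.sum_sq_norm_inner_right z
      simp only [Real.norm_eq_abs, sq_abs] at h2
      rw [h2, h1]
    have hadj : ∀ i, inner ℝ (b i) (WithLp.toLp 2 ((jacobi v p n).mulVec y.ofLp)) =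
        e i * inner ℝ (b i) y := by
      intro i
      have h1 := hA.mulVec_eigenvectorBasis i
      simp only [EuclideanSpace.inner_eq_star_dotProduct, star_trivial]
      rw [dotProduct_comm, Matrix.dotProduct_mulVec, ← Matrix.mulVec_transpose]
      have h2 : (jacobi v p n).transpose = jacobi v p n := by
        have := hA.eq
        rwa [Matrix.conjTranspose_eq_transpose_of_trivial] at this
      rw [h2]
      erw [h1]
      rw [smul_dotProduct, smul_eq_mul, dotProduct_comm]
    refine ⟨fun i => inner ℝ (b i) y, ?_, ?_, ?_, ?_⟩
    · intro i hi
      refine Submodule.span_induction (p := fun y _ => inner ℝ (b i) y = 0) ?_ ?_ ?_ ?_ hy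
      · rintro _ ⟨j, rfl⟩
        exact b.orthonormal.2 (fun h => hi (h ▸ j.2))
      · simp
      · intro x z _ _ hx hz
        rw [inner_add_right, hx, hz, add_zero]
      · intro c x _ hx
        rw [inner_smul_right, hx, mul_zero]
    · rw [sum_window, ← hnorm]
      exact Finset.sum_congr rfl fun i _ => by
        rw [show B y = windowExtend p n y.ofLp from rfl, windowExtend_apply_add]
    · rw [sum_window]
      have h3 : ∑ i, (y i) * (jacobi v p n).mulVec y.ofLp i = ∑ i, inner ℝ (b i) y *
          inner ℝ (b i) (WithLp.toLp 2 ((jacobi v p n).mulVec y.ofLp)) := by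
        have h4 := b.sum_inner_mul_inner y (WithLp.toLp 2 ((jacobi v p n).mulVec y.ofLp))
        have h5 : inner ℝ y (WithLp.toLp 2 ((jacobi v p n).mulVec y.ofLp)) =
            ∑ i, (y i) * (jacobi v p n).mulVec y.ofLp i := by
          simp [PiLp.inner_apply, mul_comm]
        rw [← h5, ← h4]
        exact Finset.sum_congr rfl fun i _ => by rw [real_inner_comm]
      refine Eq.trans ?_ (h3.trans ?_)
      · exact Finset.sum_congr rfl fun i _ => by
          rw [show B y = windowExtend p n y.ofLp from rfl, windowExtend_apply_add, jacobi_mulVec]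
      · exact Finset.sum_congr rfl fun i _ => by rw [hadj]; ring
    · intro E
      rw [sum_window]
      have h6 := hnorm (WithLp.toLp 2 ((jacobi v p n).mulVec y.ofLp) - E • y)
      refine Eq.trans ?_ (h6.trans ?_)
      · exact Finset.sum_congr rfl fun i _ => by
          rw [show B y = windowExtend p n y.ofLp from rfl, windowExtend_apply_add,
            ← jacobi_mulVec]
          simp
      · refine Finset.sum_congr rfl fun i _ => ?_
        rw [inner_sub_right, hadj, inner_smul_right]
        ring


theorem exists_subspace_le (v : ℤ → ℝ) (p : ℤ) (n : ℕ) (E : ℝ) :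
    ∃ X : Submodule ℝ (ℤ → ℝ), X ≤ window p n ∧ Module.finrank ℝ X = cnt v p n E ∧
      ∀ x ∈ X, ∑ i ∈ Finset.Ico p (p + n), x i * jop v x i ≤
        E * ∑ i ∈ Finset.Ico p (p + n), x i ^ 2 := by
  obtain ⟨X, hX, hd, h⟩ := exists_spectral_subspace v p n
    (Finset.univ.filter fun i => (jacobi_isHermitian v p n).eigenvalues i ≤ E)
  refine ⟨X, hX, hd, fun x hx => ?_⟩
  obtain ⟨c, hc, h1, h2, -⟩ := h x hx
  rw [h1, h2, Finset.mul_sum]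
  refine Finset.sum_le_sum fun i _ => ?_
  by_cases hi : (jacobi_isHermitian v p n).eigenvalues i ≤ E
  · exact mul_le_mul_of_nonneg_right hi (sq_nonneg _)
  · simp [hc i (by simpa using hi)]

theorem eq_zero_of_sum_window_eq_zero {p : ℤ} {n : ℕ} {x : ℤ → ℝ} (hx : x ∈ window p n)
    (h : ∑ i ∈ Finset.Ico p (p + n), x i ^ 2 ≤ 0) : x = 0 := by
  have h0 : ∑ i ∈ Finset.Ico p (p + n), x i ^ 2 = 0 :=
    le_antisymm h (Finset.sum_nonneg fun _ _ => sq_nonneg _)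
  rw [Finset.sum_eq_zero_iff_of_nonneg fun _ _ => sq_nonneg _] at h0
  ext i
  by_cases hi : i ∈ Finset.Ico p (p + n)
  · exact pow_eq_zero_iff (two_ne_zero) |>.1 (h0 i hi)
  · exact hx i hi

theorem exists_subspace_gt (v : ℤ → ℝ) (p : ℤ) (n : ℕ) (E : ℝ) :
    ∃ Y : Submodule ℝ (ℤ → ℝ), Y ≤ window p n ∧ Module.finrank ℝ Y + cnt v p n E = n ∧
      ∀ x ∈ Y, x ≠ 0 → E * ∑ i ∈ Finset.Ico p (p + n), x i ^ 2 <
        ∑ i ∈ Finset.Ico p (p + n), x i * jop v x i := by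
  obtain ⟨Y, hY, hd, h⟩ := exists_spectral_subspace v p n
    (Finset.univ.filter fun i => ¬ (jacobi_isHermitian v p n).eigenvalues i ≤ E)
  refine ⟨Y, hY, ?_, fun x hx hx0 => ?_⟩
  · rw [hd, cnt, add_comm, Finset.card_filter_add_card_filter_not]
    simp
  · obtain ⟨c, hc, h1, h2, -⟩ := h x hx
    rw [h1, h2, Finset.mul_sum]
    have hle : ∀ i ∈ Finset.univ, E * c i ^ 2 ≤
        (jacobi_isHermitian v p n).eigenvalues i * c i ^ 2 := by
      intro i _
      by_cases hi : (jacobi_isHermitian v p n).eigenvalues i ≤ E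
      · simp [hc i (by simpa using hi)]
      · exact mul_le_mul_of_nonneg_right (not_le.1 hi).le (sq_nonneg _)
    refine Finset.sum_lt_sum hle ?_
    by_contra! hcon
    apply hx0
    apply eq_zero_of_sum_window_eq_zero (hY hx)
    rw [h1]
    refine (Finset.sum_eq_zero fun i _ => ?_).le
    by_cases hi : (jacobi_isHermitian v p n).eigenvalues i ≤ E
    · simp [hc i (by simpa using hi)]
    · have h3 := hcon i (Finset.mem_univ _)
      have h4 : 0 < (jacobi_isHermitian v p n).eigenvalues i - E := sub_pos.2 (not_le.1 hi)
      have h5 := sq_nonneg (c i)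
      by_contra h6
      have h7 : 0 < c i ^ 2 := lt_of_le_of_ne h5 (Ne.symm h6)
      nlinarith [mul_pos h4 h7]

theorem exists_subspace_near (v : ℤ → ℝ) (p : ℤ) (n : ℕ) (E : ℝ) {δ : ℝ} (hδ : 0 ≤ δ) :
    ∃ D : Submodule ℝ (ℤ → ℝ), D ≤ window p n ∧
      Module.finrank ℝ D + cnt v p n (E - δ) = cnt v p n (E + δ) ∧
      ∀ x ∈ D, ∑ i ∈ Finset.Ico p (p + n), (jop v x i - E * x i) ^ 2 ≤
        δ ^ 2 * ∑ i ∈ Finset.Ico p (p + n), x i ^ 2 := by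
  obtain ⟨D, hD, hd, h⟩ := exists_spectral_subspace v p n
    ((Finset.univ.filter fun i => (jacobi_isHermitian v p n).eigenvalues i ≤ E + δ) \
      (Finset.univ.filter fun i => (jacobi_isHermitian v p n).eigenvalues i ≤ E - δ))
  refine ⟨D, hD, ?_, fun x hx => ?_⟩
  · rw [hd]
    refine Finset.card_sdiff_add_card_eq_card fun i hi => ?_
    simp only [Finset.mem_filter] at hi ⊢
    exact ⟨hi.1, by linarith [hi.2]⟩
  · obtain ⟨c, hc, h1, -, h2⟩ := h x hx
    rw [h1, h2, Finset.mul_sum]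
    refine Finset.sum_le_sum fun i _ => ?_
    by_cases hi : i ∈ (Finset.univ.filter fun i =>
        (jacobi_isHermitian v p n).eigenvalues i ≤ E + δ) \
      (Finset.univ.filter fun i => (jacobi_isHermitian v p n).eigenvalues i ≤ E - δ)
    · simp only [Finset.mem_sdiff, Finset.mem_filter, Finset.mem_univ, true_and, not_le] at hi
      refine mul_le_mul_of_nonneg_right ?_ (sq_nonneg _)
      apply sq_le_sq'
      · linarith [hi.2]
      · linarith [hi.1]
    · simp [hc i hi]

/-! ### Counts under perturbation of potential and energy -/

theorem cnt_le_cnt_of_close {v v' : ℤ → ℝ} {p : ℤ} {n : ℕ} {E δ : ℝ}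
    (h : ∀ i, |v i - v' i| ≤ δ) : cnt v p n E ≤ cnt v' p n (E + δ) := by
  obtain ⟨X, hX, hXd, hXq⟩ := exists_subspace_le v p n E
  obtain ⟨Y, hY, hYd, hYq⟩ := exists_subspace_gt v' p n (E + δ)
  have := finrank_add_le_of_disjoint_window hX hY fun x hx hy => by
    by_contra hx0
    have h1 := hXq x hx
    have h2 := hYq x hy hx0
    have h3 : ∑ i ∈ Finset.Ico p (p + n), x i * jop v' x i ≤
        ∑ i ∈ Finset.Ico p (p + n), (x i * jop v x i + δ * x i ^ 2) := by
      refine Finset.sum_le_sum fun i _ => ?_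
      simp only [jop]
      have h4 := mul_le_mul_of_nonneg_right (neg_le_of_abs_le (h i)) (sq_nonneg (x i))
      nlinarith
    rw [Finset.sum_add_distrib, ← Finset.mul_sum] at h3
    linarith
  omega

/-- Both counts lie between the counts of `v` at E - δ and E + δ, so the change is controlled by the
eigenvalues of one reference potential near E. -/
theorem abs_cnt_sub_cnt_le {v v' : ℤ → ℝ} {p : ℤ} {n : ℕ} {E E' δ₁ δ₂ δ : ℝ}
    (h : ∀ i, |v i - v' i| ≤ δ₁) (hE : |E - E'| ≤ δ₂) (hδ : δ₁ + δ₂ ≤ δ) :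
    |(cnt v' p n E' : ℝ) - cnt v p n E| ≤ (cnt v p n (E + δ) : ℝ) - cnt v p n (E - δ) := by
  have h0 : 0 ≤ δ₁ := (abs_nonneg _).trans (h 0)
  have h1 : 0 ≤ δ₂ := (abs_nonneg _).trans hE
  have h' : ∀ i, |v' i - v i| ≤ δ₁ := fun i => by rw [abs_sub_comm]; exact h i
  rw [abs_le] at hE
  have a1 : cnt v' p n E' ≤ cnt v p n (E + δ) :=
    (cnt_le_cnt_of_close h').trans (cnt_mono _ _ _ (by linarith))
  have a2 : cnt v p n (E - δ) ≤ cnt v' p n E' :=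
    (cnt_le_cnt_of_close h).trans (cnt_mono _ _ _ (by linarith))
  have a3 : cnt v p n E ≤ cnt v p n (E + δ) := cnt_mono _ _ _ (by linarith)
  have a4 : cnt v p n (E - δ) ≤ cnt v p n E := cnt_mono _ _ _ (by linarith)
  have b1 : (cnt v' p n E' : ℝ) ≤ cnt v p n (E + δ) := by exact_mod_cast a1
  have b2 : (cnt v p n (E - δ) : ℝ) ≤ cnt v' p n E' := by exact_mod_cast a2
  have b3 : (cnt v p n E : ℝ) ≤ cnt v p n (E + δ) := by exact_mod_cast a3
  have b4 : (cnt v p n (E - δ) : ℝ) ≤ cnt v p n E := by exact_mod_cast a4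
  rw [abs_le]
  constructor <;> linarith

/-! ### Gluing adjacent windows -/

theorem window_mono {p q : ℤ} {m n : ℕ} (h1 : p ≤ q) (h2 : q + m ≤ p + n) :
    window q m ≤ window p n := by
  intro x hx i hi
  refine hx i fun h => hi ?_
  rw [Finset.mem_Ico] at h ⊢
  omega

/-- Glue test spaces on adjacent windows, imposing a zero at the last site of the first one. -/
theorem exists_subspace_glue (v : ℤ → ℝ) (p : ℤ) (m n : ℕ) {X₁ X₂ : Submodule ℝ (ℤ → ℝ)}
    (h₁ : X₁ ≤ window p m) (h₂ : X₂ ≤ window (p + m) n) :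
    ∃ X : Submodule ℝ (ℤ → ℝ), X ≤ window p (m + n) ∧
      Module.finrank ℝ X₁ + Module.finrank ℝ X₂ ≤ Module.finrank ℝ X + 1 ∧
      ∀ x ∈ X, ∃ x₁ ∈ X₁, ∃ x₂ ∈ X₂, x = x₁ + x₂ ∧
        (∑ i ∈ Finset.Ico p (p + (m + n : ℕ)), x i ^ 2 =
          ∑ i ∈ Finset.Ico p (p + m), x₁ i ^ 2 +
            ∑ i ∈ Finset.Ico (p + m) (p + m + n), x₂ i ^ 2) ∧
        (∑ i ∈ Finset.Ico p (p + (m + n : ℕ)), x i * jop v x i =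
          ∑ i ∈ Finset.Ico p (p + m), x₁ i * jop v x₁ i +
            ∑ i ∈ Finset.Ico (p + m) (p + m + n), x₂ i * jop v x₂ i) := by
  have f₁ : FiniteDimensional ℝ X₁ := Submodule.finiteDimensional_of_le h₁
  have f₂ : FiniteDimensional ℝ X₂ := Submodule.finiteDimensional_of_le h₂
  set X₀ := X₁ ⊓ LinearMap.ker (LinearMap.proj (p + m - 1) : (ℤ → ℝ) →ₗ[ℝ] ℝ) with hX₀
  have hle : X₀ ≤ X₁ := inf_le_left
  have f₀ : FiniteDimensional ℝ X₀ := Submodule.finiteDimensional_of_le hle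
  have hdim := finrank_le_inf_ker_add_one X₁ (p + m - 1)
  rw [← hX₀] at hdim
  have hw1 : window p m ≤ window p (m + n) := window_mono le_rfl (by push_cast; omega)
  have hw2 : window (p + m) n ≤ window p (m + n) := window_mono (by omega) (by push_cast; omega)
  have hinf : X₀ ⊓ X₂ = ⊥ := by
    rw [eq_bot_iff]
    rintro x ⟨hx1, hx2⟩
    ext i
    by_cases hi : i ∈ Finset.Ico p (p + m)
    · refine h₂ hx2 i ?_
      rw [Finset.mem_Ico] at hi ⊢
      omega
    · exact h₁ (hle hx1) i hi
  have hsup := Submodule.finrank_sup_add_finrank_inf_eq X₀ X₂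
  rw [hinf, finrank_bot, add_zero] at hsup
  refine ⟨X₀ ⊔ X₂, sup_le (hle.trans (h₁.trans hw1)) (h₂.trans hw2), by omega, ?_⟩
  intro x hx
  obtain ⟨x₁, hx₁, x₂, hx₂, rfl⟩ := Submodule.mem_sup.1 hx
  have z : x₁ (p + m - 1) = 0 := by simpa using hx₁.2
  have z₁ : ∀ i, i ∉ Finset.Ico p (p + m - 1) → x₁ i = 0 := by
    intro i hi
    by_cases e : i = p + m - 1
    · rw [e, z]
    · refine h₁ (hle hx₁) i ?_
      rw [Finset.mem_Ico] at hi ⊢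
      omega
  have z₂ : ∀ i, i ∉ Finset.Ico (p + m) (p + m + n) → x₂ i = 0 := h₂ hx₂
  -- The zero at the site p + m - 1 leaves an empty site between the supports, so every nearest
  -- neighbour cross term vanishes.
  have far : ∀ i j, |i - j| ≤ 1 → x₁ i * x₂ j = 0 := by
    intro i j hij
    rw [abs_le] at hij
    by_cases hi : i ∈ Finset.Ico p (p + m - 1)
    · rw [z₂ j, mul_zero]
      rw [Finset.mem_Ico] at hi ⊢
      omega
    · rw [z₁ i hi, zero_mul]
  have s₁ : ∀ f : ℤ → ℝ, (∀ i, x₁ i = 0 → f i = 0) →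
      ∑ i ∈ Finset.Ico p (p + (m + n : ℕ)), f i = ∑ i ∈ Finset.Ico p (p + m), f i := by
    intro f hf
    symm
    refine Finset.sum_subset (fun i hi => ?_) fun i _ hi => hf i (h₁ (hle hx₁) i hi)
    rw [Finset.mem_Ico] at hi ⊢
    push_cast
    omega
  have s₂ : ∀ f : ℤ → ℝ, (∀ i, x₂ i = 0 → f i = 0) →
      ∑ i ∈ Finset.Ico p (p + (m + n : ℕ)), f i =
        ∑ i ∈ Finset.Ico (p + m) (p + m + n), f i := by
    intro f hf
    symm
    refine Finset.sum_subset (fun i hi => ?_) fun i _ hi => hf i (h₂ hx₂ i hi)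
    rw [Finset.mem_Ico] at hi ⊢
    push_cast
    omega
  refine ⟨x₁, hle hx₁, x₂, hx₂, rfl, ?_, ?_⟩
  · rw [← s₁ (fun i => x₁ i ^ 2) fun i hi => by simp [hi],
      ← s₂ (fun i => x₂ i ^ 2) fun i hi => by simp [hi], ← Finset.sum_add_distrib]
    refine Finset.sum_congr rfl fun i _ => ?_
    have := far i i (by simp)
    simp only [Pi.add_apply]
    linear_combination 2 * this
  · rw [← s₁ (fun i => x₁ i * jop v x₁ i) fun i hi => by simp [hi],
      ← s₂ (fun i => x₂ i * jop v x₂ i) fun i hi => by simp [hi], ← Finset.sum_add_distrib]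
    refine Finset.sum_congr rfl fun i _ => ?_
    have e0 := far i i (by simp)
    have e1 := far i (i + 1) (by simp)
    have e2 := far i (i - 1) (by simp)
    have e3 := far (i + 1) i (by simp)
    have e4 := far (i - 1) i (by simp)
    simp only [Pi.add_apply, jop]
    linear_combination (2 * v i) * e0 + e1 + e2 + e3 + e4

theorem cnt_add_cnt_le (v : ℤ → ℝ) (p : ℤ) (m n : ℕ) (E : ℝ) :
    cnt v p m E + cnt v (p + m) n E ≤ cnt v p (m + n) E + 1 := by
  obtain ⟨X₁, h₁, d₁, q₁⟩ := exists_subspace_le v p m E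
  obtain ⟨X₂, h₂, d₂, q₂⟩ := exists_subspace_le v (p + m) n E
  obtain ⟨X, hX, dX, qX⟩ := exists_subspace_glue v p m n h₁ h₂
  obtain ⟨Y, hY, dY, qY⟩ := exists_subspace_gt v p (m + n) E
  have := finrank_add_le_of_disjoint_window hX hY fun x hx hy => by
    by_contra hx0
    obtain ⟨x₁, hx₁, x₂, hx₂, -, e1, e2⟩ := qX x hx
    have := qY x hy hx0
    rw [e1, e2] at this
    linarith [q₁ x₁ hx₁, q₂ x₂ hx₂]
  omega

/-- Dual to the preceding inequality, with test spaces where the form exceeds E. Strictness survives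
gluing because a nonzero sum has a nonzero piece. -/
theorem cnt_le_cnt_add (v : ℤ → ℝ) (p : ℤ) (m n : ℕ) (E : ℝ) :
    cnt v p (m + n) E ≤ cnt v p m E + cnt v (p + m) n E + 1 := by
  obtain ⟨X₁, h₁, d₁, q₁⟩ := exists_subspace_gt v p m E
  obtain ⟨X₂, h₂, d₂, q₂⟩ := exists_subspace_gt v (p + m) n E
  obtain ⟨X, hX, dX, qX⟩ := exists_subspace_glue v p m n h₁ h₂
  obtain ⟨Y, hY, dY, qY⟩ := exists_subspace_le v p (m + n) E
  have := finrank_add_le_of_disjoint_window hX hY fun x hx hy => by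
    by_contra hx0
    obtain ⟨x₁, hx₁, x₂, hx₂, hxx, e1, e2⟩ := qX x hx
    have h := qY x hy
    rw [e1, e2] at h
    have k₁ : E * ∑ i ∈ Finset.Ico p (p + m), x₁ i ^ 2 ≤
        ∑ i ∈ Finset.Ico p (p + m), x₁ i * jop v x₁ i := by
      by_cases z : x₁ = 0
      · simp [z]
      · exact (q₁ x₁ hx₁ z).le
    have k₂ : E * ∑ i ∈ Finset.Ico (p + m) (p + m + n), x₂ i ^ 2 ≤
        ∑ i ∈ Finset.Ico (p + m) (p + m + n), x₂ i * jop v x₂ i := by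
      by_cases z : x₂ = 0
      · simp [z]
      · exact (q₂ x₂ hx₂ z).le
    by_cases z : x₁ = 0
    · have z' : x₂ ≠ 0 := by
        rintro rfl
        exact hx0 (by rw [hxx, z, add_zero])
      linarith [q₂ x₂ hx₂ z']
    · linarith [q₁ x₁ hx₁ z]
  omega

/-! ### Eigenvalues in short energy intervals -/

/-- Solutions with a zero at both ends of an edge are controlled by the inhomogeneity. -/
theorem exists_growth_const (C E : ℝ) (L : ℕ) : ∃ R : ℝ, 0 ≤ R ∧ ∀ (v : ℤ → ℝ),
    (∀ i, |v i| ≤ C) → ∀ (p : ℤ) (x : ℤ → ℝ) (S : ℝ), x (p - 1) = 0 → x p = 0 → 0 ≤ S →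
      (∀ i ∈ Finset.Ico p (p + L), (jop v x i - E * x i) ^ 2 ≤ S) →
      ∀ k : ℕ, k ≤ L → x (p + k) ^ 2 + x (p + k - 1) ^ 2 ≤ R * S := by
  -- Bounds one step of the recurrence: the factor 3 comes from squaring a sum of three terms, and
  -- the last 1 carries over the previous value.
  set K : ℝ := 3 * (1 + (C + |E|) ^ 2) + 1 with hK
  have hK0 : 0 ≤ K := by positivity
  induction L with
  | zero =>
    refine ⟨0, le_rfl, fun v _ p x S h0 h1 _ _ k hk => ?_⟩
    obtain rfl : k = 0 := by omega
    simp [h0, h1]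
  | succ N ih =>
    obtain ⟨R, hR, ih⟩ := ih
    refine ⟨K * (R + 1), by positivity, fun v hv p x S h0 h1 hS hf k hk => ?_⟩
    have ih' := ih v hv p x S h0 h1 hS fun i hi => hf i (by
      rw [Finset.mem_Ico] at hi ⊢; push_cast; omega)
    have hK1 : 1 ≤ K := by rw [hK]; nlinarith [sq_nonneg (C + |E|)]
    rcases Nat.lt_or_ge k (N + 1) with hk' | hk'
    · refine (ih' k (by omega)).trans ?_
      nlinarith [mul_nonneg hR hS, mul_nonneg (mul_nonneg (sub_nonneg.2 hK1) hR) hS,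
        mul_nonneg hK0 hS]
    · obtain rfl : k = N + 1 := by omega
      have u := ih' N le_rfl
      have f := hf (p + N) (by rw [Finset.mem_Ico]; push_cast; omega)
      have e : x (p + N + 1) = (jop v x (p + N) - E * x (p + N)) +
          (E - v (p + N)) * x (p + N) + (- x (p + N - 1)) := by
        simp only [jop]; ring
      set F := jop v x (p + N) - E * x (p + N)
      have hb : (E - v (p + N)) ^ 2 ≤ (C + |E|) ^ 2 := by
        apply sq_le_sq'
        · have := abs_le.1 (hv (p + N)); have := neg_abs_le E; linarith
        · have := abs_le.1 (hv (p + N)); have := le_abs_self E; linarith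
      have t : ∀ a b c : ℝ, (a + b + c) ^ 2 ≤ 3 * (a ^ 2 + b ^ 2 + c ^ 2) := fun a b c => by
        nlinarith [sq_nonneg (a - b), sq_nonneg (b - c), sq_nonneg (a - c)]
      have e1 : x (p + (N + 1 : ℕ)) ^ 2 ≤
          3 * (F ^ 2 + (C + |E|) ^ 2 * x (p + N) ^ 2 + x (p + N - 1) ^ 2) := by
        rw [show p + ((N + 1 : ℕ) : ℤ) = p + N + 1 by push_cast; ring, e]
        refine (t _ _ _).trans ?_
        rw [mul_pow]
        nlinarith [mul_le_mul_of_nonneg_right hb (sq_nonneg (x (p + N)))]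
      rw [show p + ((N + 1 : ℕ) : ℤ) - 1 = p + N by push_cast; ring]
      have q0 := sq_nonneg (x (p + N))
      have q1 := sq_nonneg (x (p + N - 1))
      have q2 := sq_nonneg (C + |E|)
      have e2 : x (p + (N + 1 : ℕ)) ^ 2 + x (p + N) ^ 2 ≤
          K * (F ^ 2 + (x (p + N) ^ 2 + x (p + N - 1) ^ 2)) := by
        rw [hK]
        nlinarith [mul_nonneg q2 q1, mul_nonneg q2 (sq_nonneg F), sq_nonneg F]
      refine e2.trans ?_
      rw [mul_assoc]
      refine mul_le_mul_of_nonneg_left ?_ hK0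
      linarith

/-- A Dirichlet sequence has one free parameter, its value at `p`. If that vanishes too, the
sequence is controlled by its residual, so an approximate eigenvector with small enough error is
zero. The bound is uniform over potentials bounded by `C`. -/
theorem exists_cnt_block_le (C E : ℝ) (L : ℕ) : ∃ δ > 0, ∀ v : ℤ → ℝ, (∀ i, |v i| ≤ C) →
    ∀ p, cnt v p L (E + δ) ≤ cnt v p L (E - δ) + 1 := by
  obtain ⟨R, hR, h⟩ := exists_growth_const C E L
  -- With δ = 1/(2Q) one has L R δ² < 1, which closes the estimate.
  set Q : ℝ := L * R + 1 with hQ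
  have hQ0 : 0 < Q := by positivity
  have hδ : (0 : ℝ) < 1 / (2 * Q) := by positivity
  refine ⟨1 / (2 * Q), hδ, fun v hv p => ?_⟩
  obtain ⟨D, hD, hd, hq⟩ := exists_subspace_near v p L E hδ.le
  have fD : FiniteDimensional ℝ D := Submodule.finiteDimensional_of_le hD
  have h1 := finrank_le_inf_ker_add_one D p
  have h2 : D ⊓ LinearMap.ker (LinearMap.proj p : (ℤ → ℝ) →ₗ[ℝ] ℝ) = ⊥ := by
    rw [eq_bot_iff]
    rintro x ⟨hx, hx0⟩
    have hx0 : x p = 0 := by simpa using hx0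
    have hx1 : x (p - 1) = 0 := hD hx _ (by rw [Finset.mem_Ico]; omega)
    set S := ∑ i ∈ Finset.Ico p (p + L), (jop v x i - E * x i) ^ 2 with hS
    have hS0 : 0 ≤ S := Finset.sum_nonneg fun _ _ => sq_nonneg _
    have h3 := h v hv p x S hx1 hx0 hS0 fun i hi =>
      Finset.single_le_sum (f := fun i => (jop v x i - E * x i) ^ 2)
        (fun _ _ => sq_nonneg _) hi
    have h4 : ∑ i ∈ Finset.Ico p (p + L), x i ^ 2 ≤ L * (R * S) := by
      rw [sum_window]
      refine (Finset.sum_le_card_nsmul _ _ (R * S) fun i _ => ?_).trans (by simp)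
      linarith [h3 i i.2.le, sq_nonneg (x (p + (i : ℕ) - 1))]
    have h5 := hq x hx
    rw [← hS] at h5
    refine eq_zero_of_sum_window_eq_zero (hD hx) ?_
    set T := ∑ i ∈ Finset.Ico p (p + L), x i ^ 2 with hT
    have hT0 : 0 ≤ T := Finset.sum_nonneg fun _ _ => sq_nonneg _
    by_contra hcon
    have h6 : T ≤ (L * R) * ((1 / (2 * Q)) ^ 2 * T) := by
      have : (0 : ℝ) ≤ L * R := by positivity
      nlinarith [mul_le_mul_of_nonneg_left h5 this]
    have h7 : (L * R) * (1 / (2 * Q)) ^ 2 < 1 := by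
      rw [div_pow, one_pow, mul_one_div, div_lt_one (by positivity)]
      nlinarith [mul_pos hQ0 hQ0]
    nlinarith
  rw [h2, finrank_bot] at h1
  omega

/-- The density of eigenvalues in a short interval is small. -/
theorem exists_cnt_sub_le (C E : ℝ) {ε : ℝ} (hε : 0 < ε) : ∃ δ > 0, ∃ K : ℝ, ∀ v : ℤ → ℝ,
    (∀ i, |v i| ≤ C) → ∀ (p : ℤ) (n : ℕ),
      (cnt v p n (E + δ) : ℝ) - cnt v p n (E - δ) ≤ ε * n + K := by
  -- Each block of length L costs at most 3: one eigenvalue of its own and one unit for each of the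
  -- two gluing inequalities.
  obtain ⟨L, hL⟩ := exists_nat_gt (3 / ε)
  have hL0 : (0 : ℝ) < L := (by positivity : 0 < 3 / ε).trans hL
  obtain ⟨δ, hδ, h⟩ := exists_cnt_block_le C E L
  refine ⟨δ, hδ, L, fun v hv p n => ?_⟩
  have key : ∀ (k r : ℕ) (p : ℤ), cnt v p (r + L * k) (E + δ) ≤
      cnt v p (r + L * k) (E - δ) + 3 * k + r := by
    intro k
    induction k with
    | zero =>
      intro r p
      have := cnt_le v p r (E + δ)
      simp only [mul_zero, add_zero]
      omega
    | succ k ih =>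
      intro r p
      have a1 := cnt_add_cnt_le v p L (r + L * k) (E - δ)
      have a2 := cnt_le_cnt_add v p L (r + L * k) (E + δ)
      have a3 := ih r (p + L)
      have a4 := h v hv p
      rw [show r + L * (k + 1) = L + (r + L * k) by ring]
      omega
  have h1 := key (n / L) (n % L) p
  rw [Nat.mod_add_div] at h1
  have h2 : (cnt v p n (E + δ) : ℝ) ≤ cnt v p n (E - δ) + 3 * (n / L : ℕ) + (n % L : ℕ) := by
    exact_mod_cast h1
  have h3 : ((n % L : ℕ) : ℝ) ≤ L := by
    exact_mod_cast (Nat.mod_lt n (by exact_mod_cast hL0)).le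
  have h4 : ((n / L : ℕ) : ℝ) ≤ n / L := Nat.cast_div_le
  have h5 : 3 * ((n : ℝ) / L) ≤ ε * n := by
    rw [div_lt_iff₀ hε] at hL
    rw [← mul_div_assoc, div_le_iff₀ hL0]
    nlinarith [(Nat.cast_nonneg n : (0 : ℝ) ≤ n)]
  linarith

/-- The discrete Schrödinger operator with potential `v` is bounded below by `η` on real `ℓ²`. -/
def BoundedBelow (v : ℤ → ℝ) (η : ℝ) : Prop :=
  ∀ x : ℤ → ℝ, Summable (fun i => x i ^ 2) → η ^ 2 * ∑' i, x i ^ 2 ≤ ∑' i, jop v x i ^ 2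

/-- Zeros at the first and last site make `jop` of the zero extension vanish outside the window. The
window residual is then the full one, and an error δ < η is impossible. The two zeros cost two
dimensions. -/
theorem cnt_le_add_two_of_boundedBelow {v : ℤ → ℝ} {E η δ : ℝ}
    (h : BoundedBelow (fun i => v i - E) η) (hδ : 0 ≤ δ) (hδη : δ < η) (p : ℤ) (n : ℕ) :
    cnt v p n (E + δ) ≤ cnt v p n (E - δ) + 2 := by
  obtain ⟨D, hD, hd, hq⟩ := exists_subspace_near v p n E hδ
  have fD : FiniteDimensional ℝ D := Submodule.finiteDimensional_of_le hD
  have h1 := finrank_le_inf_ker_add_one D p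
  set D₁ := D ⊓ LinearMap.ker (LinearMap.proj p : (ℤ → ℝ) →ₗ[ℝ] ℝ) with hD₁
  have fD₁ : FiniteDimensional ℝ D₁ := Submodule.finiteDimensional_of_le inf_le_left
  have h2 := finrank_le_inf_ker_add_one D₁ (p + n - 1)
  have h3 : D₁ ⊓ LinearMap.ker (LinearMap.proj (p + n - 1) : (ℤ → ℝ) →ₗ[ℝ] ℝ) = ⊥ := by
    rw [eq_bot_iff]
    rintro x ⟨⟨hx, hx0⟩, hx1⟩
    have hx0 : x p = 0 := by simpa using hx0
    have hx1 : x (p + n - 1) = 0 := by simpa using hx1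
    have hx2 : ∀ i, i ∉ Finset.Ico p (p + n) → x i = 0 := hD hx
    have e : ∀ i, jop (fun i => v i - E) x i = jop v x i - E * x i := fun i => by
      simp only [jop]; ring
    have z : ∀ i, i ∉ Finset.Ico p (p + n) → jop v x i = 0 := by
      intro i hi
      have hr : x (i + 1) = 0 := by
        by_cases c : i + 1 = p
        · rw [c, hx0]
        · exact hx2 _ (by rw [Finset.mem_Ico] at hi ⊢; omega)
      have hl : x (i - 1) = 0 := by
        by_cases c : i - 1 = p + n - 1
        · rw [c, hx1]
        · exact hx2 _ (by rw [Finset.mem_Ico] at hi ⊢; omega)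
      simp [jop, hr, hl, hx2 i hi]
    have s0 : ∀ i, i ∉ Finset.Ico p (p + n) → x i ^ 2 = 0 := fun i hi => by simp [hx2 i hi]
    have h4 := h x (summable_of_ne_finset_zero s0)
    simp only [e] at h4
    rw [tsum_eq_sum s0, tsum_eq_sum fun i hi => by simp [z i hi, hx2 i hi]] at h4
    have h5 := hq x hx
    refine eq_zero_of_sum_window_eq_zero (hD hx) ?_
    by_contra hcon
    have : δ ^ 2 < η ^ 2 := by nlinarith
    nlinarith
  rw [h3, finrank_bot] at h2
  omega


/-! ### Existence of the integrated density of states -/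

/-- The rotation angle `2πω` as a point of the circle. -/
def rot (ω : ℝ) : Torus := ((2 * Real.pi * ω : ℝ) : Torus)

theorem site_eq (V : C(Torus, ℝ)) (ω : ℝ) (φ : Torus) (n : ℤ) :
    site V ω φ n = V (n • rot ω + φ) := by
  rw [site, rot, ← AddCircle.coe_zsmul, zsmul_eq_mul, mul_comm (n : ℝ)]

theorem site_add (V : C(Torus, ℝ)) (ω : ℝ) (φ : Torus) (p n : ℤ) :
    site V ω φ (p + n) = site V ω (φ + p • rot ω) n := by
  rw [site_eq, site_eq, add_zsmul]
  congr 1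
  abel

theorem abs_site_le (V : C(Torus, ℝ)) (ω : ℝ) (φ : Torus) (n : ℤ) : |site V ω φ n| ≤ ‖V‖ :=
  V.norm_coe_le_norm _

theorem cnt_site_shift (V : C(Torus, ℝ)) (ω : ℝ) (φ : Torus) (p : ℤ) (n : ℕ) (E : ℝ) :
    cnt (site V ω φ) p n E = cnt (site V ω (φ + p • rot ω)) 0 n E :=
  cnt_congr (fun i _ => by rw [site_add, zero_add]) E

theorem idsApprox_eq (V : C(Torus, ℝ)) (ω : ℝ) (φ : Torus) (E : ℝ) (N : ℕ) :
    idsApprox V ω φ E N = (cnt (site V ω φ) (-N) (2 * N + 1) E : ℝ) / (2 * N + 1) := by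
  have h : truncation V ω φ N = jacobi (site V ω φ) (-N) (2 * N + 1) := by
    ext i j
    simp only [truncation, jacobi, Matrix.of_apply]
    rw [sub_eq_neg_add]
  unfold idsApprox cnt
  congr! 6

theorem sin_ne_zero_of_isDiophantine {ω : ℝ} (hω : IsDiophantine ω) {k : ℤ} (hk : k ≠ 0) :
    Real.sin (2 * Real.pi * k * ω) ≠ 0 := by
  obtain ⟨c, hc, τ, -, h⟩ := hω
  have h1 := h k hk
  have h2 : (0 : ℝ) < |(k : ℝ)| ^ τ := Real.rpow_pos_of_pos (by positivity) _
  exact abs_pos.1 ((div_pos hc h2).trans h1)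

theorem zsmul_rot_ne_zero {ω : ℝ} (hω : IsDiophantine ω) {k : ℤ} (hk : k ≠ 0) :
    k • rot ω ≠ 0 := by
  intro h
  rw [rot, ← AddCircle.coe_zsmul, AddCircle.coe_eq_zero_iff] at h
  obtain ⟨m, hm⟩ := h
  apply sin_ne_zero_of_isDiophantine hω hk
  rw [zsmul_eq_mul, zsmul_eq_mul] at hm
  rw [show 2 * Real.pi * k * ω = ((2 * m : ℤ) : ℝ) * Real.pi by push_cast; linarith]
  exact Real.sin_int_mul_pi _

theorem denseRange_zsmul_rot {ω : ℝ} (hω : IsDiophantine ω) :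
    DenseRange (fun k : ℤ => k • rot ω) := by
  rw [AddCircle.denseRange_zsmul_iff, addOrderOf_eq_zero_iff, isOfFinAddOrder_iff_zsmul_eq_zero]
  rintro ⟨k, hk, h⟩
  exact zsmul_rot_ne_zero hω hk h

/-- Nearby phases give uniformly close potentials; phases on one orbit are compared by shifting the
window, at a cost growing with the shift. By density and compactness finitely many shifts suffice,
so `K` is uniform in the phases. -/
theorem exists_abs_cnt_site_sub_le {ω : ℝ} (hd : DenseRange (fun k : ℤ => k • rot ω))
    (V : C(Torus, ℝ)) (E : ℝ) {ε : ℝ} (hε : 0 < ε) : ∃ K : ℝ, ∀ (φ φ' : Torus) (n : ℕ),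
      |(cnt (site V ω φ) 0 n E : ℝ) - cnt (site V ω φ') 0 n E| ≤ ε * n + K := by
  obtain ⟨δ, hδ, K, hK⟩ := exists_cnt_sub_le ‖V‖ E hε
  obtain ⟨η, hη, hV⟩ := Metric.uniformContinuous_iff.1
    (CompactSpace.uniformContinuous_of_continuous V.continuous) δ hδ
  have near : ∀ (φ φ' : Torus) (n : ℕ), dist φ φ' < η →
      |(cnt (site V ω φ') 0 n E : ℝ) - cnt (site V ω φ) 0 n E| ≤ ε * n + K := by
    intro φ φ' n h
    refine (abs_cnt_sub_cnt_le (δ₁ := δ) (δ₂ := 0) (δ := δ) (fun i => ?_) (by simp)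
      (by simp)).trans (hK _ (abs_site_le V ω φ) 0 n)
    have := hV (a := i • rot ω + φ) (b := i • rot ω + φ') (by rwa [dist_add_left])
    rw [site_eq, site_eq]
    exact this.le
  have shift₀ : ∀ (φ : Torus) (m n : ℕ),
      |(cnt (site V ω (φ + (m : ℤ) • rot ω)) 0 n E : ℝ) - cnt (site V ω φ) 0 n E| ≤ m + 2 := by
    intro φ m n
    -- The window of length m + n is split after m sites and after n sites; comparing the two
    -- splittings relates the shifted window to the original one.
    have a1 := cnt_add_cnt_le (site V ω φ) 0 m n E
    have a2 := cnt_le_cnt_add (site V ω φ) 0 m n E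
    have a3 := cnt_add_cnt_le (site V ω φ) 0 n m E
    have a4 := cnt_le_cnt_add (site V ω φ) 0 n m E
    have a5 := cnt_le (site V ω φ) 0 m E
    have a6 := cnt_le (site V ω φ) (0 + n) m E
    rw [cnt_site_shift V ω φ (0 + m) n, zero_add] at a1 a2
    rw [add_comm n m] at a3 a4
    rw [abs_le]
    constructor
    · have : cnt (site V ω φ) 0 n E ≤ cnt (site V ω (φ + (m : ℤ) • rot ω)) 0 n E + m + 2 := by
        omega
      have : (cnt (site V ω φ) 0 n E : ℝ) ≤
        cnt (site V ω (φ + (m : ℤ) • rot ω)) 0 n E + m + 2 := by exact_mod_cast this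
      linarith
    · have : cnt (site V ω (φ + (m : ℤ) • rot ω)) 0 n E ≤ cnt (site V ω φ) 0 n E + m + 2 := by
        omega
      have : (cnt (site V ω (φ + (m : ℤ) • rot ω)) 0 n E : ℝ) ≤
        cnt (site V ω φ) 0 n E + m + 2 := by exact_mod_cast this
      linarith
  have shift : ∀ (φ : Torus) (m : ℤ) (n : ℕ),
      |(cnt (site V ω (φ + m • rot ω)) 0 n E : ℝ) - cnt (site V ω φ) 0 n E| ≤ |(m : ℝ)| + 2 := by
    intro φ m n
    obtain ⟨k, rfl | rfl⟩ := m.eq_nat_or_neg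
    · simpa using shift₀ φ k n
    · have := shift₀ (φ + (-(k : ℤ)) • rot ω) k n
      rw [add_assoc, ← add_zsmul, neg_add_cancel, zero_zsmul, add_zero, abs_sub_comm] at this
      simpa using this
  obtain ⟨t, ht⟩ := isCompact_univ.elim_finite_subcover
    (fun m : ℤ => Metric.ball (m • rot ω) η) (fun _ => Metric.isOpen_ball) (by
      intro ψ _
      obtain ⟨m, hm⟩ := hd.exists_dist_lt ψ hη
      exact Set.mem_iUnion.2 ⟨m, hm⟩)
  refine ⟨∑ m ∈ t, |(m : ℝ)| + 2 + K, fun φ φ' n => ?_⟩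
  obtain ⟨m, hm⟩ := Set.mem_iUnion.1 (ht (Set.mem_univ (φ' - φ)))
  obtain ⟨hmt, hm⟩ := Set.mem_iUnion.1 hm
  have h1 := near φ' (φ + m • rot ω) n (by
    have h2 := Metric.mem_ball.1 hm
    rwa [← dist_add_left φ, add_sub_cancel] at h2)
  have h2 := shift φ m n
  have h3 : |(m : ℝ)| ≤ ∑ m ∈ t, |(m : ℝ)| :=
    Finset.single_le_sum (f := fun m : ℤ => |(m : ℝ)|) (fun _ _ => abs_nonneg _) hmt
  rw [abs_le] at h1 h2 ⊢
  constructor <;> linarith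

/-- Fekete-type argument: with blocks of length L > C/ε each gluing error is at most 2εL, a relative
error 2ε in total, and the remainder adds ε for large n. Hence the quotients form a Cauchy sequence.
-/
theorem exists_tendsto_div_of_almost_additive {a : ℕ → ℝ}
    (h : ∀ ε > 0, ∃ C : ℝ, ∀ m n : ℕ, |a (m + n) - a m - a n| ≤ ε * n + C) :
    ∃ κ : ℝ, Tendsto (fun n : ℕ => a n / n) atTop (𝓝 κ) := by
  have key : ∀ ε > 0, ∃ c : ℝ, ∃ N : ℕ, ∀ n ≥ N, |a n / n - c| ≤ 3 * ε := by
    intro ε hε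
    obtain ⟨C, hC⟩ := h ε hε
    have hC0 : 0 ≤ C := by simpa using (abs_nonneg _).trans (hC 0 0)
    obtain ⟨L, hL⟩ := exists_nat_gt (C / ε)
    have hL0 : (0 : ℝ) < L := (by positivity : 0 ≤ C / ε).trans_lt hL
    have hLp : 0 < L := by exact_mod_cast hL0
    have hCL : C ≤ ε * L := by
      rw [div_lt_iff₀ hε] at hL
      linarith
    have step : ∀ k r : ℕ, |a (r + L * k) - a r - k * a L| ≤ k * (2 * ε * L) := by
      intro k r
      induction k with
      | zero => simp
      | succ k ih =>
        have h1 := hC (r + L * k) L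
        rw [show r + L * (k + 1) = r + L * k + L by ring]
        push_cast
        rw [abs_le] at ih h1 ⊢
        constructor <;> linarith
    set M : ℝ := ∑ r ∈ Finset.range L, |a r| with hM
    obtain ⟨N, hN⟩ := exists_nat_gt ((M + |a L|) / ε)
    refine ⟨a L / L, N + 1, fun n hn => ?_⟩
    have hn0 : (0 : ℝ) < n := by exact_mod_cast (by omega : 0 < n)
    have hnN : M + |a L| ≤ ε * n := by
      rw [div_lt_iff₀ hε] at hN
      have : (N : ℝ) ≤ n := by exact_mod_cast (by omega : N ≤ n)
      nlinarith
    have h1 := step (n / L) (n % L)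
    rw [Nat.mod_add_div] at h1
    have h2 : |a (n % L)| ≤ M :=
      Finset.single_le_sum (f := fun r => |a r|) (fun _ _ => abs_nonneg _)
        (Finset.mem_range.2 (Nat.mod_lt n hLp))
    have h3 : (n : ℝ) = (n % L : ℕ) + L * (n / L : ℕ) := by
      exact_mod_cast (Nat.mod_add_div n L).symm
    have h4 : ((n % L : ℕ) : ℝ) ≤ L := by exact_mod_cast (Nat.mod_lt n hLp).le
    have h5 : (0 : ℝ) ≤ ((n % L : ℕ) : ℝ) := Nat.cast_nonneg _
    have h6 : |((n % L : ℕ) : ℝ) * (a L / L)| ≤ |a L| := by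
      rw [abs_mul, abs_div, abs_of_nonneg h5, abs_of_pos hL0, ← mul_div_assoc, div_le_iff₀ hL0]
      nlinarith [abs_nonneg (a L)]
    have h7 : a n / n - a L / L = ((a n - a (n % L) - (n / L : ℕ) * a L) + a (n % L) -
        ((n % L : ℕ) : ℝ) * (a L / L)) / n := by
      rw [eq_div_iff hn0.ne', sub_mul, div_mul_cancel₀ _ hn0.ne']
      have h8 : a L / L * L = a L := div_mul_cancel₀ _ hL0.ne'
      linear_combination (-(a L / L)) * h3 - ((n / L : ℕ) : ℝ) * h8
    rw [h7, abs_div, abs_of_pos hn0, div_le_iff₀ hn0]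
    have h8 : ((n / L : ℕ) : ℝ) * (2 * ε * L) ≤ 2 * ε * n := by
      have : (L : ℝ) * (n / L : ℕ) ≤ n := by rw [h3]; linarith
      nlinarith
    rw [abs_le] at *
    constructor <;> linarith
  apply cauchySeq_tendsto_of_complete
  rw [Metric.cauchySeq_iff']
  intro ε hε
  -- Two deviations of 3ε/7 add up to less than ε.
  obtain ⟨c, N, hN⟩ := key (ε / 7) (by positivity)
  refine ⟨N, fun n hn => ?_⟩
  have h1 := hN n hn
  have h2 := hN N le_rfl
  rw [Real.dist_eq, abs_lt]
  rw [abs_le] at h1 h2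
  constructor <;> linarith

/-- Almost additivity gives the limit at phase 0 on windows starting at 0. Other phases and the
centred windows are translates, covered by uniformity in the phase. -/
theorem exists_hasIDS {ω : ℝ} (hd : DenseRange (fun k : ℤ => k • rot ω))
    (V : C(Torus, ℝ)) (E : ℝ) : ∃ κ : ℝ, HasIDS V ω E κ := by
  obtain ⟨κ, hκ⟩ := exists_tendsto_div_of_almost_additive
    (a := fun n => (cnt (site V ω 0) 0 n E : ℝ)) (by
      intro ε hε
      obtain ⟨K, hK⟩ := exists_abs_cnt_site_sub_le hd V E hε
      refine ⟨K + 1, fun m n => ?_⟩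
      have h1 := cnt_add_cnt_le (site V ω 0) 0 m n E
      have h2 := cnt_le_cnt_add (site V ω 0) 0 m n E
      rw [cnt_site_shift V ω 0 (0 + m) n] at h1 h2
      have h3 := hK (0 + (0 + (m : ℤ)) • rot ω) 0 n
      have h4 : (cnt (site V ω 0) 0 m E : ℝ) + cnt (site V ω (0 + (0 + (m : ℤ)) • rot ω)) 0 n E ≤
        cnt (site V ω 0) 0 (m + n) E + 1 := by exact_mod_cast h1
      have h5 : (cnt (site V ω 0) 0 (m + n) E : ℝ) ≤ cnt (site V ω 0) 0 m E +
        cnt (site V ω (0 + (0 + (m : ℤ)) • rot ω)) 0 n E + 1 := by exact_mod_cast h2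
      rw [abs_le] at h3 ⊢
      constructor <;> linarith)
  refine ⟨κ, fun φ => ?_⟩
  have hN : Tendsto (fun N : ℕ => 2 * N + 1) atTop atTop :=
    tendsto_atTop_mono (fun N => (by omega : N ≤ 2 * N + 1)) tendsto_id
  have h1 := hκ.comp hN
  have h2 : Tendsto (fun N : ℕ => idsApprox V ω φ E N -
      (cnt (site V ω 0) 0 (2 * N + 1) E : ℝ) / (2 * N + 1 : ℕ)) atTop (𝓝 0) := by
    rw [Metric.tendsto_atTop]
    intro ε hε
    obtain ⟨K, hK⟩ := exists_abs_cnt_site_sub_le hd V E (half_pos hε)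
    obtain ⟨N₀, hN₀⟩ := exists_nat_gt (K / (ε / 2))
    refine ⟨N₀, fun N hN => ?_⟩
    have hpos : (0 : ℝ) < 2 * N + 1 := by positivity
    rw [idsApprox_eq, cnt_site_shift, Real.dist_eq, sub_zero]
    push_cast
    rw [← sub_div, abs_div, abs_of_pos hpos, div_lt_iff₀ hpos]
    refine (hK _ 0 (2 * N + 1)).trans_lt ?_
    push_cast
    rw [div_lt_iff₀ (by positivity)] at hN₀
    have : (N₀ : ℝ) ≤ N := by exact_mod_cast hN
    have : (0 : ℝ) ≤ N := Nat.cast_nonneg _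
    nlinarith
  have h3 := h2.add h1
  rw [zero_add] at h3
  refine h3.congr fun N => ?_
  simp


/-! ### The integrated density of states along a path -/

theorem abs_ids_sub_le {V V' : C(Torus, ℝ)} {ω E E' κ κ' ε K : ℝ} (h : HasIDS V ω E κ)
    (h' : HasIDS V' ω E' κ') (φ : Torus)
    (hc : ∀ (p : ℤ) (n : ℕ),
      |(cnt (site V' ω φ) p n E' : ℝ) - cnt (site V ω φ) p n E| ≤ ε * n + K) :
    |κ' - κ| ≤ ε := by
  have h1 : Tendsto (fun N => |idsApprox V' ω φ E' N - idsApprox V ω φ E N|) atTop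
      (𝓝 |κ' - κ|) := ((h' φ).sub (h φ)).abs
  have h2 : Tendsto (fun N : ℕ => ε + K / ((2 * N + 1 : ℕ) : ℝ)) atTop (𝓝 (ε + 0)) := by
    refine tendsto_const_nhds.add ?_
    exact (tendsto_const_div_atTop_nhds_zero_nat K).comp
      (tendsto_atTop_mono (fun N => (by omega : N ≤ 2 * N + 1)) tendsto_id)
  rw [add_zero] at h2
  refine le_of_tendsto_of_tendsto' h1 h2 fun N => ?_
  have hpos : (0 : ℝ) < 2 * N + 1 := by positivity
  have h3 := hc (-N) (2 * N + 1)
  rw [idsApprox_eq, idsApprox_eq, ← sub_div, abs_div, abs_of_pos hpos, div_le_iff₀ hpos]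
  push_cast at h3 ⊢
  rw [add_mul, div_mul_cancel₀ _ hpos.ne']
  exact h3

theorem site_add_smul (V U : C(Torus, ℝ)) (s ω : ℝ) (φ : Torus) (i : ℤ) :
    site (V + s • U) ω φ i = site V ω φ i + s * site U ω φ i := rfl

theorem abs_cnt_path_sub_le (V U : C(Torus, ℝ)) (a μ ω s s' δ : ℝ) (φ : Torus)
    (hδ : |s' - s| * (‖U‖ + |μ|) ≤ δ) (p : ℤ) (n : ℕ) :
    |(cnt (site (V + s' • U) ω φ) p n (a + s' * μ) : ℝ) -
        cnt (site (V + s • U) ω φ) p n (a + s * μ)| ≤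
      (cnt (site (V + s • U) ω φ) p n (a + s * μ + δ) : ℝ) -
        cnt (site (V + s • U) ω φ) p n (a + s * μ - δ) := by
  refine abs_cnt_sub_cnt_le (δ₁ := |s' - s| * ‖U‖) (δ₂ := |s' - s| * |μ|) (fun i => ?_) ?_
    (by rwa [← mul_add])
  · rw [site_add_smul, site_add_smul,
      show ∀ b c : ℝ, b + s * c - (b + s' * c) = (s - s') * c by intros; ring, abs_mul,
      abs_sub_comm]
    exact mul_le_mul_of_nonneg_left (abs_site_le U ω φ i) (abs_nonneg _)
  · rw [show a + s * μ - (a + s' * μ) = (s - s') * μ by ring, abs_mul, abs_sub_comm]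

/-- The integrated density of states is constant along a path of resolvent energies. -/
theorem hasIDS_path {ω : ℝ} (hd : DenseRange (fun k : ℤ => k • rot ω)) (V U : C(Torus, ℝ))
    (a μ : ℝ) {l r : ℝ} (φ : Torus)
    (hb : ∀ s ∈ Set.Ioo l r, ∃ η > 0,
      BoundedBelow (fun i => site (V + s • U) ω φ i - (a + s * μ)) η)
    {s₁ s₂ κ : ℝ} (h₁ : s₁ ∈ Set.Ioo l r) (h₂ : s₂ ∈ Set.Ioo l r)
    (h : HasIDS (V + s₁ • U) ω (a + s₁ * μ) κ) : HasIDS (V + s₂ • U) ω (a + s₂ * μ) κ := by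
  choose f hf using fun s : ℝ => exists_hasIDS hd (V + s • U) (a + s * μ)
  have loc : ∀ s ∈ Set.Ioo l r, ∀ᶠ s' in 𝓝 s, f s' = f s := by
    intro s hs
    obtain ⟨η, hη, hB⟩ := hb s hs
    have hcont : Tendsto (fun s' => |s' - s| * (‖U‖ + |μ|)) (𝓝 s) (𝓝 (|s - s| * (‖U‖ + |μ|))) :=
      (by fun_prop : Continuous fun s' => |s' - s| * (‖U‖ + |μ|)).tendsto s
    rw [sub_self, abs_zero, zero_mul] at hcont
    filter_upwards [hcont.eventually (gt_mem_nhds (half_pos hη))] with s' hs'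
    -- Counts that differ by a bounded amount have equal densities, hence ε = 0.
    have key := abs_ids_sub_le (ε := 0) (K := 2) (hf s) (hf s') φ fun p n => by
      refine (abs_cnt_path_sub_le V U a μ ω s s' (η / 2) φ hs'.le p n).trans ?_
      have := cnt_le_add_two_of_boundedBelow hB (half_pos hη).le (half_lt_self hη) p n
      have : (cnt (site (V + s • U) ω φ) p n (a + s * μ + η / 2) : ℝ) ≤
        cnt (site (V + s • U) ω φ) p n (a + s * μ - η / 2) + 2 := by exact_mod_cast this
      linarith
    exact sub_eq_zero.1 (abs_eq_zero.1 (le_antisymm key (abs_nonneg _)))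
  have hder : ∀ s ∈ Set.Ioo l r, HasDerivAt f 0 s := fun s hs =>
    (hasDerivAt_const s (f s)).congr_of_eventuallyEq (loc s hs)
  have hconst := isOpen_Ioo.is_const_of_deriv_eq_zero isPreconnected_Ioo
    (fun s hs => (hder s hs).differentiableAt.differentiableWithinAt)
    (fun s hs => (hder s hs).deriv) h₁ h₂
  have e : f s₁ = κ := tendsto_nhds_unique (hf s₁ φ) (h φ)
  rw [← e, hconst]
  exact hf s₂

/-- No lower bound is assumed at s = 0, so constancy alone does not reach that endpoint. Continuity
of the density at `(V, a)` gives an error ε at some small s', and constancy transports it to `s`. -/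
theorem hasIDS_of_path_tendsto {ω : ℝ} (hd : DenseRange (fun k : ℤ => k • rot ω))
    (V U : C(Torus, ℝ)) (a μ : ℝ) {s₀ κ : ℝ} (φ : Torus)
    (hb : ∀ s ∈ Set.Ioo 0 s₀, ∃ η > 0,
      BoundedBelow (fun i => site (V + s • U) ω φ i - (a + s * μ)) η)
    (h : HasIDS V ω a κ) {s : ℝ} (hs : s ∈ Set.Ioo 0 s₀) :
    HasIDS (V + s • U) ω (a + s * μ) κ := by
  obtain ⟨κ', hκ'⟩ := exists_hasIDS hd (V + s • U) (a + s * μ)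
  suffices hsmall : ∀ ε > 0, |κ' - κ| ≤ ε by
    have : |κ' - κ| ≤ 0 := le_of_forall_pos_le_add fun ε hε => by simpa using hsmall ε hε
    rw [sub_eq_zero.1 (abs_eq_zero.1 (le_antisymm this (abs_nonneg _)))] at hκ'
    exact hκ'
  intro ε hε
  obtain ⟨δ, hδ, K, hK⟩ := exists_cnt_sub_le ‖V‖ a hε
  have hcont : Tendsto (fun s' => |s' - 0| * (‖U‖ + |μ|)) (𝓝[>] 0)
      (𝓝 (|(0 : ℝ) - 0| * (‖U‖ + |μ|))) :=
    ((by fun_prop : Continuous fun s' : ℝ => |s' - 0| * (‖U‖ + |μ|)).tendsto 0).mono_left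
      nhdsWithin_le_nhds
  rw [sub_self, abs_zero, zero_mul] at hcont
  obtain ⟨s', hs', hs'2⟩ := ((hcont.eventually (gt_mem_nhds hδ)).and
    (Ioo_mem_nhdsGT (hs.1.trans hs.2))).exists
  have h1 := hasIDS_path hd V U a μ φ hb hs hs'2 hκ'
  refine abs_ids_sub_le (K := K) h h1 φ fun p n => ?_
  have h2 := abs_cnt_path_sub_le V U a μ ω 0 s' δ φ hs'.le p n
  simp only [zero_smul, zero_mul, add_zero] at h2
  exact h2.trans (hK _ (abs_site_le V ω φ) p n)

/-! ### Bounded below operators -/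

theorem summable_shift {f : ℤ → ℝ} (hf : Summable f) : Summable fun n => f (n + 1) :=
  (Equiv.addRight (1 : ℤ)).summable_iff.2 hf

theorem summable_shift_sub {f : ℤ → ℝ} (hf : Summable f) : Summable fun n => f (n - 1) :=
  (Equiv.subRight (1 : ℤ)).summable_iff.2 hf

theorem summable_jop_sq {v x : ℤ → ℝ} {C : ℝ} (hv : ∀ i, |v i| ≤ C)
    (hx : Summable fun i => x i ^ 2) : Summable fun i => jop v x i ^ 2 := by
  have h1 : Summable fun i => x (i + 1) ^ 2 :=
    summable_shift (f := fun i => x i ^ 2) hx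
  have h2 : Summable fun i => x (i - 1) ^ 2 :=
    summable_shift_sub (f := fun i => x i ^ 2) hx
  have t : ∀ a b c : ℝ, (a + b + c) ^ 2 ≤ 3 * (a ^ 2 + b ^ 2 + c ^ 2) := fun a b c => by
    nlinarith [sq_nonneg (a - b), sq_nonneg (b - c), sq_nonneg (a - c)]
  refine Summable.of_nonneg_of_le (fun _ => sq_nonneg _) (fun i => ?_)
    (((h1.add h2).add (hx.mul_left (C ^ 2))).mul_left 3)
  have hv2 : v i ^ 2 ≤ C ^ 2 := sq_le_sq' (by linarith [abs_le.1 (hv i)]) (abs_le.1 (hv i)).2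
  have h3 := mul_le_mul_of_nonneg_right hv2 (sq_nonneg (x i))
  refine (t _ _ _).trans ?_
  rw [mul_pow]
  linarith

theorem BoundedBelow.of_close {v v' : ℤ → ℝ} {η C : ℝ} (h : BoundedBelow v η)
    (hC : ∀ i, |v' i| ≤ C) (hv : ∀ i, |v i - v' i| ≤ η / 2) : BoundedBelow v' (η / 2) := by
  intro x hx
  have h1 := h x hx
  have s' := summable_jop_sq hC hx
  have h2 : ∑' i, jop v x i ^ 2 ≤ ∑' i, (2 * jop v' x i ^ 2 + η ^ 2 / 2 * x i ^ 2) := by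
    refine Summable.tsum_le_tsum (fun i => ?_) (summable_jop_sq (C := C + η / 2) (fun i => ?_) hx)
      ((s'.mul_left 2).add (hx.mul_left _))
    · have e : jop v x i = jop v' x i + (v i - v' i) * x i := by simp only [jop]; ring
      have hq : (v i - v' i) ^ 2 ≤ (η / 2) ^ 2 :=
        sq_le_sq' (by linarith [abs_le.1 (hv i)]) (abs_le.1 (hv i)).2
      have := mul_le_mul_of_nonneg_right hq (sq_nonneg (x i))
      rw [e]
      nlinarith [sq_nonneg (jop v' x i - (v i - v' i) * x i)]
    · have a1 := abs_le.1 (hv i)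
      have a2 := abs_le.1 (hC i)
      rw [abs_le]
      constructor <;> linarith
  rw [Summable.tsum_add (s'.mul_left 2) (hx.mul_left _), tsum_mul_left, tsum_mul_left] at h2
  linarith

theorem BoundedBelow.shift {v : ℤ → ℝ} {η : ℝ} (h : BoundedBelow v η) (p : ℤ) :
    BoundedBelow (fun i => v (p + i)) η := by
  intro x hx
  have h1 := h (fun i => x (i - p)) ((Equiv.subRight p).summable_iff.2 hx)
  have e1 : ∑' i, x (i - p) ^ 2 = ∑' i, x i ^ 2 := (Equiv.subRight p).tsum_eq (fun i => x i ^ 2)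
  have e2 : ∑' i, jop v (fun i => x (i - p)) i ^ 2 =
      ∑' i, jop (fun i => v (p + i)) x i ^ 2 := by
    rw [← (Equiv.subRight p).tsum_eq (fun i => jop (fun i => v (p + i)) x i ^ 2)]
    refine tsum_congr fun i => ?_
    simp only [jop, Equiv.subRight_apply]
    rw [show i - p + 1 = i + 1 - p by ring, show i - p - 1 = i - 1 - p by ring,
      show p + (i - p) = i by ring]
  rwa [e1, e2] at h1

/-- Some point of the orbit of φ is so close to φ' that the two potentials differ by at most η/2 at
every site; translation along the orbit preserves the bound. -/
theorem boundedBelow_site_phase {ω : ℝ} (hd : DenseRange (fun k : ℤ => k • rot ω))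
    (V : C(Torus, ℝ)) (E : ℝ) {φ : Torus} {η : ℝ} (hη : 0 < η)
    (h : BoundedBelow (fun i => site V ω φ i - E) η) (φ' : Torus) :
    BoundedBelow (fun i => site V ω φ' i - E) (η / 2) := by
  obtain ⟨ε, hε, hV⟩ := Metric.uniformContinuous_iff.1
    (CompactSpace.uniformContinuous_of_continuous V.continuous) (η / 2) (half_pos hη)
  obtain ⟨m, hm⟩ := hd.exists_dist_lt (φ' - φ) hε
  refine BoundedBelow.of_close (C := ‖V‖ + |E|) (h.shift m)
    (fun i => (abs_sub _ _).trans (add_le_add (abs_site_le V ω φ' i) le_rfl)) fun i => ?_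
  have := hV (a := i • rot ω + (φ + m • rot ω)) (b := i • rot ω + φ') (by
    rw [dist_add_left, dist_comm]
    rwa [← dist_add_left φ, add_sub_cancel] at hm)
  rw [site_add, site_eq, site_eq, sub_sub_sub_cancel_right]
  exact this.le


/-! ### The spectrum of the Schrödinger operator -/

theorem ellTwo_summable (x : EllTwo) : Summable fun i => ‖x i‖ ^ 2 := by
  have := (lp.memℓp x).summable (by norm_num)
  simpa using this

theorem ellTwo_norm_sq (x : EllTwo) : ‖x‖ ^ 2 = ∑' i, ‖x i‖ ^ 2 := by
  have := lp.norm_rpow_eq_tsum (p := 2) (by norm_num) x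
  simpa using this

theorem inner_permute (e : ℤ ≃ ℤ) (x y : EllTwo) :
    inner ℂ (permute e x) y = inner ℂ x (permute e.symm y) := by
  rw [lp.inner_eq_tsum, lp.inner_eq_tsum, ← e.tsum_eq fun i => inner ℂ (x i) (permute e.symm y i)]
  refine tsum_congr fun i => ?_
  have : permute e.symm y (e i) = y i := congrArg (⇑y) (e.symm_apply_apply i)
  rw [this]
  rfl

theorem schrodingerOp_isSelfAdjoint (V : C(Torus, ℝ)) (ω : ℝ) (φ : Torus) :
    IsSelfAdjoint (schrodingerOp V ω φ) := by
  rw [ContinuousLinearMap.isSelfAdjoint_iff_isSymmetric]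
  intro x y
  have h1 : (Equiv.addRight (1 : ℤ)).symm = Equiv.addRight (-1) := rfl
  have h2 : (Equiv.addRight (-1 : ℤ)).symm = Equiv.addRight 1 := by
    rw [← h1, Equiv.symm_symm]
  simp only [schrodingerOp, ContinuousLinearMap.coe_coe, _root_.add_apply,
    inner_add_left, inner_add_right]
  rw [inner_permute, inner_permute, h1, h2, add_comm (inner ℂ x _) (inner ℂ x _)]
  congr 1
  rw [lp.inner_eq_tsum, lp.inner_eq_tsum]
  refine tsum_congr fun i => ?_
  change inner ℂ ((site V ω φ i : ℂ) * x i) (y i) = inner ℂ (x i) ((site V ω φ i : ℂ) * y i)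
  simp
  ring

/-- The operator `H - E`. -/
def shiftedOp (V : C(Torus, ℝ)) (ω : ℝ) (φ : Torus) (E : ℝ) : EllTwo →L[ℂ] EllTwo :=
  schrodingerOp V ω φ - algebraMap ℂ _ (E : ℂ)

theorem shiftedOp_apply (V : C(Torus, ℝ)) (ω : ℝ) (φ : Torus) (E : ℝ) (x : EllTwo) (n : ℤ) :
    shiftedOp V ω φ E x n = x (n + 1) + x (n - 1) + ((site V ω φ n - E : ℝ) : ℂ) * x n := by
  have h : shiftedOp V ω φ E x n = schrodingerOp V ω φ x n - (E : ℂ) * x n := rfl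
  rw [h, schrodingerOp_apply]
  push_cast
  ring

theorem shiftedOp_isSelfAdjoint (V : C(Torus, ℝ)) (ω : ℝ) (φ : Torus) (E : ℝ) :
    IsSelfAdjoint (shiftedOp V ω φ E) := by
  refine (schrodingerOp_isSelfAdjoint V ω φ).sub ?_
  rw [IsSelfAdjoint, ← algebraMap_star_comm]
  simp

theorem notMem_schrodingerSpectrum_iff (V : C(Torus, ℝ)) (ω : ℝ) (φ : Torus) (E : ℝ) :
    E ∉ schrodingerSpectrum V ω φ ↔ IsUnit (shiftedOp V ω φ E) := by
  rw [schrodingerSpectrum, Set.mem_ofPred_eq, spectrum.notMem_iff, shiftedOp, IsUnit.sub_iff]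

theorem re_shiftedOp (V : C(Torus, ℝ)) (ω : ℝ) (φ : Torus) (E : ℝ) (x : EllTwo) (n : ℤ) :
    (shiftedOp V ω φ E x n).re = jop (fun i => site V ω φ i - E) (fun i => (x i).re) n := by
  simp [shiftedOp_apply, jop, -Complex.ofReal_sub]

theorem im_shiftedOp (V : C(Torus, ℝ)) (ω : ℝ) (φ : Torus) (E : ℝ) (x : EllTwo) (n : ℤ) :
    (shiftedOp V ω φ E x n).im = jop (fun i => site V ω φ i - E) (fun i => (x i).im) n := by
  simp [shiftedOp_apply, jop, -Complex.ofReal_sub]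

theorem abs_site_sub_le (V : C(Torus, ℝ)) (ω : ℝ) (φ : Torus) (E : ℝ) (i : ℤ) :
    |site V ω φ i - E| ≤ ‖V‖ + |E| :=
  (abs_sub _ _).trans (add_le_add (abs_site_le V ω φ i) le_rfl)

/-- The operator has real coefficients, so real and imaginary parts can be treated separately. -/
theorem norm_shiftedOp_ge {V : C(Torus, ℝ)} {ω : ℝ} {φ : Torus} {E η : ℝ} (hη : 0 ≤ η)
    (h : BoundedBelow (fun i => site V ω φ i - E) η) (x : EllTwo) :
    η * ‖x‖ ≤ ‖shiftedOp V ω φ E x‖ := by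
  have key : ∀ z : ℂ, ‖z‖ ^ 2 = z.re ^ 2 + z.im ^ 2 := fun z => by
    rw [Complex.sq_norm, Complex.normSq_apply]; ring
  have hs := ellTwo_summable x
  have hr : Summable fun i => (x i).re ^ 2 :=
    Summable.of_nonneg_of_le (fun _ => sq_nonneg _)
      (fun i => by rw [key]; linarith [sq_nonneg (x i).im]) hs
  have hi : Summable fun i => (x i).im ^ 2 :=
    Summable.of_nonneg_of_le (fun _ => sq_nonneg _)
      (fun i => by rw [key]; linarith [sq_nonneg (x i).re]) hs
  have h1 := h _ hr
  have h2 := h _ hi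
  have e1 : ‖x‖ ^ 2 = ∑' i, (x i).re ^ 2 + ∑' i, (x i).im ^ 2 := by
    rw [ellTwo_norm_sq, ← hr.tsum_add hi]
    exact tsum_congr fun i => key _
  have e2 : ‖shiftedOp V ω φ E x‖ ^ 2 =
      ∑' i, jop (fun i => site V ω φ i - E) (fun i => (x i).re) i ^ 2 +
        ∑' i, jop (fun i => site V ω φ i - E) (fun i => (x i).im) i ^ 2 := by
    rw [ellTwo_norm_sq, ← (summable_jop_sq (abs_site_sub_le V ω φ E) hr).tsum_add
      (summable_jop_sq (abs_site_sub_le V ω φ E) hi)]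
    exact tsum_congr fun i => by rw [key, re_shiftedOp, im_shiftedOp]
  refine (pow_le_pow_iff_left₀ (by positivity) (norm_nonneg _) two_ne_zero).1 ?_
  rw [mul_pow, e1, e2]
  linarith

/-- The lower bound gives injectivity and closed range; by self-adjointness the orthogonal
complement of the range is the kernel, so the range is dense as well. -/
theorem notMem_schrodingerSpectrum_of_boundedBelow {V : C(Torus, ℝ)} {ω : ℝ} {φ : Torus}
    {E η : ℝ} (hη : 0 < η) (h : BoundedBelow (fun i => site V ω φ i - E) η) :
    E ∉ schrodingerSpectrum V ω φ := by
  rw [notMem_schrodingerSpectrum_iff, ContinuousLinearMap.isUnit_iff_bijective,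
    ContinuousLinearMap.bijective_iff_dense_range_and_antilipschitz]
  have hanti : AntilipschitzWith (η.toNNReal⁻¹) (shiftedOp V ω φ E) := by
    refine (shiftedOp V ω φ E).antilipschitz_of_bound fun x => ?_
    rw [NNReal.coe_inv, Real.coe_toNNReal _ hη.le, inv_mul_eq_div, le_div_iff₀ hη, mul_comm]
    exact norm_shiftedOp_ge hη.le h x
  refine ⟨?_, _, hanti⟩
  rw [Submodule.topologicalClosure_eq_top_iff, ContinuousLinearMap.orthogonal_range,
    (shiftedOp_isSelfAdjoint V ω φ E).adjoint_eq]
  exact LinearMap.ker_eq_bot.2 hanti.injective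

theorem exists_boundedBelow {V : C(Torus, ℝ)} {ω : ℝ} {φ : Torus} {E : ℝ}
    (h : E ∉ schrodingerSpectrum V ω φ) :
    ∃ η > 0, BoundedBelow (fun i => site V ω φ i - E) η := by
  rw [notMem_schrodingerSpectrum_iff] at h
  obtain ⟨T, hT⟩ := h
  set R : EllTwo →L[ℂ] EllTwo := ↑T⁻¹ with hR
  have hRT : ∀ x, R (shiftedOp V ω φ E x) = x := by
    intro x
    rw [← hT, hR, ← mul_apply_eq_comp, Units.inv_mul, one_apply_eq_self]
  refine ⟨1 / (‖R‖ + 1), by positivity, fun x hx => ?_⟩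
  let X : EllTwo := ⟨fun i => (x i : ℂ), memℓp_gen (by simpa using hx)⟩
  have hX : ∀ i, X i = (x i : ℂ) := fun _ => rfl
  have e1 : ‖X‖ ^ 2 = ∑' i, x i ^ 2 := by
    rw [ellTwo_norm_sq]
    exact tsum_congr fun i => by rw [hX, Complex.norm_real, Real.norm_eq_abs, sq_abs]
  have e2 : ‖shiftedOp V ω φ E X‖ ^ 2 = ∑' i, jop (fun i => site V ω φ i - E) x i ^ 2 := by
    rw [ellTwo_norm_sq]
    refine tsum_congr fun i => ?_
    have : shiftedOp V ω φ E X i = ((jop (fun i => site V ω φ i - E) x i : ℝ) : ℂ) := by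
      rw [shiftedOp_apply, hX, hX, hX, jop]
      push_cast
      ring
    rw [this, Complex.norm_real, Real.norm_eq_abs, sq_abs]
  rw [← e1, ← e2, ← mul_pow]
  refine pow_le_pow_left₀ (by positivity) ?_ 2
  rw [one_div_mul_eq_div, div_le_iff₀ (by positivity)]
  calc ‖X‖ = ‖R (shiftedOp V ω φ E X)‖ := by rw [hRT]
    _ ≤ ‖R‖ * ‖shiftedOp V ω φ E X‖ := R.le_opNorm _
    _ ≤ ‖shiftedOp V ω φ E X‖ * (‖R‖ + 1) := by
      nlinarith [norm_nonneg (shiftedOp V ω φ E X)]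

theorem schrodingerSpectrum_phase {ω : ℝ} (hd : DenseRange (fun k : ℤ => k • rot ω))
    (V : C(Torus, ℝ)) (φ φ' : Torus) :
    schrodingerSpectrum V ω φ = schrodingerSpectrum V ω φ' := by
  have key : ∀ φ φ' : Torus, schrodingerSpectrum V ω φ' ⊆ schrodingerSpectrum V ω φ := by
    intro φ φ' E hE
    by_contra hcon
    obtain ⟨η, hη, h⟩ := exists_boundedBelow hcon
    exact notMem_schrodingerSpectrum_of_boundedBelow (half_pos hη)
      (boundedBelow_site_phase hd V E hη h φ') hE
  exact (key φ' φ).antisymm (key φ φ')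

theorem isClosed_schrodingerSpectrum (V : C(Torus, ℝ)) (ω : ℝ) (φ : Torus) :
    IsClosed (schrodingerSpectrum V ω φ) :=
  (spectrum.isClosed (𝕜 := ℂ) (schrodingerOp V ω φ)).preimage Complex.continuous_ofReal

theorem mem_spectrum_real_shiftedOp {V : C(Torus, ℝ)} {ω : ℝ} {φ : Torus} {E t : ℝ}
    (h : t ∈ spectrum ℝ (shiftedOp V ω φ E)) : E + t ∈ schrodingerSpectrum V ω φ := by
  by_contra hcon
  rw [notMem_schrodingerSpectrum_iff] at hcon
  rw [spectrum.mem_iff, IsUnit.sub_iff] at h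
  apply h
  have e : shiftedOp V ω φ E - algebraMap ℝ _ t = shiftedOp V ω φ (E + t) := by
    ext x n
    have : (shiftedOp V ω φ E - algebraMap ℝ (EllTwo →L[ℂ] EllTwo) t) x n =
      shiftedOp V ω φ E x n - (t : ℂ) * x n := rfl
    rw [this, shiftedOp_apply, shiftedOp_apply]
    push_cast
    ring
  rwa [e]

/-! ### Spectrum detected by the quadratic form -/

/-- The quadratic form of the discrete Schrödinger operator on finitely supported sequences. -/
def jform (v : ℤ → ℝ) (x : ℤ →₀ ℝ) : ℝ := ∑ i ∈ x.support, x i * jop v x i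

theorem exists_ellTwo_inner_eq_jform (V : C(Torus, ℝ)) (ω : ℝ) (φ : Torus) (E : ℝ) (x : ℤ →₀ ℝ) :
    ∃ X : EllTwo, (inner ℂ (shiftedOp V ω φ E X) X).re =
      jform (fun i => site V ω φ i - E) x := by
  have hz : ∀ i, i ∉ x.support → ‖(x i : ℂ)‖ ^ (2 : ENNReal).toReal = 0 := fun i hi => by
    simp [Finsupp.notMem_support_iff.1 hi]
  let X : EllTwo := ⟨fun i => (x i : ℂ), memℓp_gen (summable_of_ne_finset_zero hz)⟩
  have hX : ∀ i, X i = (x i : ℂ) := fun _ => rfl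
  refine ⟨X, ?_⟩
  have hi : ∀ i, inner ℂ (shiftedOp V ω φ E X i) (X i) =
      ((x i * jop (fun i => site V ω φ i - E) x i : ℝ) : ℂ) := by
    intro i
    rw [shiftedOp_apply, hX, hX, hX, jop]
    simp
  rw [lp.inner_eq_tsum, tsum_congr hi, jform, tsum_eq_sum (s := x.support), ← Complex.ofReal_sum,
    Complex.ofReal_re]
  intro i hi
  simp [Finsupp.notMem_support_iff.1 hi]

theorem isPositive_of_spectrum_nonneg {H : Type*} [NormedAddCommGroup H] [InnerProductSpace ℂ H]
    [CompleteSpace H] {T : H →L[ℂ] H} (hT : IsSelfAdjoint T)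
    (h : ∀ t ∈ spectrum ℝ T, 0 ≤ t) : T.IsPositive := by
  rwa [← ContinuousLinearMap.nonneg_iff_isPositive,
    StarOrderedRing.nonneg_iff_spectrum_nonneg (R := ℝ) _ hT]

/-- Without spectrum above `E` the operator E - H would be positive. -/
theorem exists_mem_spectrum_gt {V : C(Torus, ℝ)} {ω : ℝ} {φ : Torus} {E : ℝ} {x : ℤ →₀ ℝ}
    (hx : 0 < jform (fun i => site V ω φ i - E) x) : ∃ e ∈ schrodingerSpectrum V ω φ, E < e := by
  by_contra! hcon
  have hsa := (shiftedOp_isSelfAdjoint V ω φ E).neg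
  have hpos : (-shiftedOp V ω φ E).IsPositive := by
    refine isPositive_of_spectrum_nonneg hsa fun t ht => ?_
    rw [← spectrum.neg_eq, Set.mem_neg] at ht
    linarith [hcon _ (mem_spectrum_real_shiftedOp ht)]
  obtain ⟨X, hX⟩ := exists_ellTwo_inner_eq_jform V ω φ E x
  have := hpos.re_inner_nonneg_left X
  rw [_root_.neg_apply, inner_neg_left, map_neg] at this
  rw [← hX] at hx
  simp only [RCLike.re_to_complex] at this
  linarith

theorem exists_mem_spectrum_lt {V : C(Torus, ℝ)} {ω : ℝ} {φ : Torus} {E : ℝ} {x : ℤ →₀ ℝ}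
    (hx : jform (fun i => site V ω φ i - E) x < 0) : ∃ e ∈ schrodingerSpectrum V ω φ, e < E := by
  by_contra! hcon
  have hpos : (shiftedOp V ω φ E).IsPositive := by
    refine isPositive_of_spectrum_nonneg (shiftedOp_isSelfAdjoint V ω φ E) fun t ht => ?_
    linarith [hcon _ (mem_spectrum_real_shiftedOp ht)]
  obtain ⟨X, hX⟩ := exists_ellTwo_inner_eq_jform V ω φ E x
  have := hpos.re_inner_nonneg_left X
  rw [← hX] at hx
  simp only [RCLike.re_to_complex] at this
  linarith

/-- A resolvent energy with spectrum on both sides lies in an open gap. -/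
theorem exists_isOpenGap {ω : ℝ} (hd : DenseRange (fun k : ℤ => k • rot ω)) {V : C(Torus, ℝ)}
    {E : ℝ} (hE : E ∉ schrodingerSpectrum V ω 0) (h₁ : ∃ e ∈ schrodingerSpectrum V ω 0, e < E)
    (h₂ : ∃ e ∈ schrodingerSpectrum V ω 0, E < e) :
    ∃ l r : ℝ, IsOpenGap V ω l r ∧ E ∈ Set.Ioo l r := by
  set S := schrodingerSpectrum V ω 0 with hS
  have hcl : IsClosed S := isClosed_schrodingerSpectrum V ω 0
  obtain ⟨e₁, he₁, h₁⟩ := h₁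
  obtain ⟨e₂, he₂, h₂⟩ := h₂
  have b₁ : BddAbove (S ∩ Set.Iic E) := ⟨E, fun _ h => h.2⟩
  have b₂ : BddBelow (S ∩ Set.Ici E) := ⟨E, fun _ h => h.2⟩
  have m₁ : sSup (S ∩ Set.Iic E) ∈ S ∩ Set.Iic E :=
    (hcl.inter isClosed_Iic).csSup_mem ⟨e₁, he₁, h₁.le⟩ b₁
  have m₂ : sInf (S ∩ Set.Ici E) ∈ S ∩ Set.Ici E :=
    (hcl.inter isClosed_Ici).csInf_mem ⟨e₂, he₂, h₂.le⟩ b₂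
  have l₁ : sSup (S ∩ Set.Iic E) < E := lt_of_le_of_ne m₁.2 fun h => hE (h ▸ m₁.1)
  have l₂ : E < sInf (S ∩ Set.Ici E) := lt_of_le_of_ne m₂.2 fun h => hE (h.symm ▸ m₂.1)
  refine ⟨_, _, ⟨l₁.trans l₂, fun φ => ?_⟩, l₁, l₂⟩
  rw [schrodingerSpectrum_phase hd V φ 0, ← hS]
  refine ⟨m₁.1, m₂.1, Set.disjoint_left.2 fun e he heS => ?_⟩
  rcases le_total e E with h | h
  · exact absurd (le_csSup b₁ ⟨heS, h⟩) (not_le.2 he.1)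
  · exact absurd (csInf_le b₂ ⟨heS, h⟩) (not_le.2 he.2)

theorem hasIDS_of_gap {ω : ℝ} (hd : DenseRange (fun k : ℤ => k • rot ω)) {V : C(Torus, ℝ)}
    {l r E E' κ : ℝ} (hg : IsOpenGap V ω l r) (hE : E ∈ Set.Ioo l r) (hE' : E' ∈ Set.Ioo l r)
    (h : HasIDS V ω E κ) : HasIDS V ω E' κ := by
  -- The path has zero perturbation and unit speed, so its parameter is the energy itself.
  have := hasIDS_path hd V 0 0 1 (l := l) (r := r) 0 (fun s hs => by
    have hn : s ∉ schrodingerSpectrum V ω 0 := Set.disjoint_left.1 (hg.2 0).2.2 hs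
    simpa using exists_boundedBelow hn) hE hE' (κ := κ) (by simpa using h)
  simpa using this


/-! ### A Lyapunov function for perturbations of a reducible cocycle -/

/-- Bounded real sequences. -/
def BddSeq (f : ℤ → ℝ) : Prop := ∃ C : ℝ, ∀ i, |f i| ≤ C

theorem BddSeq.add {f g : ℤ → ℝ} (hf : BddSeq f) (hg : BddSeq g) :
    BddSeq fun i => f i + g i := by
  obtain ⟨C, hC⟩ := hf
  obtain ⟨D, hD⟩ := hg
  exact ⟨C + D, fun i => (abs_add_le _ _).trans (add_le_add (hC i) (hD i))⟩

theorem BddSeq.mul {f g : ℤ → ℝ} (hf : BddSeq f) (hg : BddSeq g) :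
    BddSeq fun i => f i * g i := by
  obtain ⟨C, hC⟩ := hf
  obtain ⟨D, hD⟩ := hg
  refine ⟨C * D, fun i => ?_⟩
  rw [abs_mul]
  exact mul_le_mul (hC i) (hD i) (abs_nonneg _) ((abs_nonneg _).trans (hC i))

theorem BddSeq.const (c : ℝ) : BddSeq fun _ => c := ⟨|c|, fun _ => le_rfl⟩

theorem BddSeq.sub {f g : ℤ → ℝ} (hf : BddSeq f) (hg : BddSeq g) :
    BddSeq fun i => f i - g i := by
  simpa [sub_eq_add_neg] using hf.add ((BddSeq.const (-1)).mul hg)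

theorem BddSeq.shift {f : ℤ → ℝ} (hf : BddSeq f) (p : ℤ) : BddSeq fun i => f (i + p) :=
  hf.imp fun _ hC i => hC (i + p)

theorem BddSeq.mul_summable {f g : ℤ → ℝ} (hf : BddSeq f) (hg : Summable g) :
    Summable fun i => f i * g i := by
  obtain ⟨C, hC⟩ := hf
  refine Summable.of_norm_bounded (hg.abs.mul_left C) fun i => ?_
  rw [Real.norm_eq_abs, abs_mul]
  exact mul_le_mul_of_nonneg_right (hC i) (abs_nonneg _)

theorem tsum_shift (f : ℤ → ℝ) : ∑' n, f (n + 1) = ∑' n, f n :=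
  (Equiv.addRight (1 : ℤ)).tsum_eq f

theorem summable_mul_of_sq {f g : ℤ → ℝ} (hf : Summable fun i => f i ^ 2)
    (hg : Summable fun i => g i ^ 2) : Summable fun i => f i * g i := by
  refine Summable.of_norm_bounded (hf.add hg) fun i => ?_
  rw [Real.norm_eq_abs, abs_le]
  constructor <;> nlinarith [sq_nonneg (f i + g i), sq_nonneg (f i - g i)]

theorem sq_linear_le {α β m w₁ w₂ : ℝ} (hα : |α| ≤ m) (hβ : |β| ≤ m) :
    (α * w₁ + β * w₂) ^ 2 ≤ 2 * m ^ 2 * (w₁ ^ 2 + w₂ ^ 2) := by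
  have h1 : α ^ 2 ≤ m ^ 2 := sq_le_sq' (by linarith [abs_le.1 hα]) (abs_le.1 hα).2
  have h2 : β ^ 2 ≤ m ^ 2 := sq_le_sq' (by linarith [abs_le.1 hβ]) (abs_le.1 hβ).2
  nlinarith [sq_nonneg (α * w₁ - β * w₂), mul_le_mul_of_nonneg_right h1 (sq_nonneg w₁),
    mul_le_mul_of_nonneg_right h2 (sq_nonneg w₂)]

/-- This is the first-order increment of p w₁² + q w₁w₂ - p w₂² under w₁' = p w₁ + q w₂, w₂' = -p
w₂, with averaging errors eᵢ. Without errors it equals p²w₁² + (p w₁ + q w₂)² + 2p²w₂², at least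
p²(w₁² + w₂²); the errors cost a quarter of that. -/
theorem averaged_form_ge {p q ε e₁ e₂ e₃ : ℝ} (hε : 4 * ε * (|p| + |q|) ≤ p ^ 2 / 4)
    (h₁ : |e₁| ≤ ε) (h₂ : |e₂| ≤ ε) (h₃ : |e₃| ≤ ε) (w₁ w₂ : ℝ) :
    3 / 4 * p ^ 2 * (w₁ ^ 2 + w₂ ^ 2) ≤
      w₁ ^ 2 * (2 * p ^ 2 + 2 * p * e₂ - q * e₁) + w₁ * w₂ * (2 * p * q + 2 * p * (e₁ + e₃)) +
        w₂ ^ 2 * (2 * p ^ 2 + q ^ 2 + 2 * p * e₂ + q * e₃) := by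
  have hε0 : 0 ≤ ε := (abs_nonneg _).trans h₁
  have b : ∀ c e : ℝ, |e| ≤ ε → -(|c| * ε) ≤ c * e := fun c e he => by
    refine neg_le_of_abs_le ?_
    rw [abs_mul]
    exact mul_le_mul_of_nonneg_left he (abs_nonneg _)
  have b1 := mul_le_mul_of_nonneg_left (b p e₂ h₂) (sq_nonneg w₁)
  have b2 := mul_le_mul_of_nonneg_left (b (-q) e₁ h₁) (sq_nonneg w₁)
  have b3 := mul_le_mul_of_nonneg_left (b p e₂ h₂) (sq_nonneg w₂)
  have b4 := mul_le_mul_of_nonneg_left (b q e₃ h₃) (sq_nonneg w₂)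
  have b5 := b (p * (w₁ * w₂)) e₁ h₁
  have b6 := b (p * (w₁ * w₂)) e₃ h₃
  have b7 : |p * (w₁ * w₂)| * ε ≤ |p| * ε * ((w₁ ^ 2 + w₂ ^ 2) / 2) := by
    have : |w₁ * w₂| ≤ (w₁ ^ 2 + w₂ ^ 2) / 2 := by
      rw [abs_le]
      constructor <;> nlinarith [sq_nonneg (w₁ + w₂), sq_nonneg (w₁ - w₂)]
    rw [abs_mul]
    calc |p| * |w₁ * w₂| * ε = |p| * ε * |w₁ * w₂| := by ring
      _ ≤ _ := mul_le_mul_of_nonneg_left this (mul_nonneg (abs_nonneg _) hε0)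
  rw [abs_neg] at b2
  have b8 := mul_le_mul_of_nonneg_right hε (add_nonneg (sq_nonneg w₁) (sq_nonneg w₂))
  have b9 := mul_nonneg (mul_nonneg hε0 (abs_nonneg q)) (add_nonneg (sq_nonneg w₁) (sq_nonneg w₂))
  nlinarith [sq_nonneg (p * w₁ + q * w₂), mul_nonneg (sq_nonneg p) (sq_nonneg w₂)]

/-- Of the gain 3/4 s p² r, Young's inequality for the two terms linear in f spends a quarter of s
p² r, and the contributions of order s² spend another by `hsK`. A quarter is left. -/
theorem lyapunov_increment_ge {p K s M l l' z f h k₁ k₂ r : ℝ} (hp : p ≠ 0) (hK : 0 < K)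
    (hs : 0 < s) (hs1 : s ≤ 1) (hsK : s * (4 * K ^ 3 + K ^ 2) ≤ p ^ 2 / 4)
    (hM : 3 / 4 * p ^ 2 * r ≤ M) (hl : l ^ 2 ≤ K ^ 2 * r) (hl' : l' ^ 2 ≤ K ^ 2 * r)
    (hz : z ^ 2 ≤ K ^ 2 * r) (hh : h = f + s * z) (hk₁ : |k₁| ≤ K) (hk₂ : |k₂| ≤ K) :
    s * p ^ 2 / 4 * r - (4 * K + 4 * K ^ 2 / (s * p ^ 2)) * f ^ 2 ≤
      s * M + f * l + h ^ 2 * k₁ + s * h * l' + s * h ^ 2 * k₂ := by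
  have hp2 : 0 < p ^ 2 := by positivity
  have hK2 : 0 < K ^ 2 := by positivity
  have hr : 0 ≤ r := by
    by_contra hcon
    nlinarith [sq_nonneg z, mul_neg_of_pos_of_neg hK2 (not_le.1 hcon)]
  -- Young weight for which each term linear in f costs s p² r / 8.
  set t : ℝ := s * p ^ 2 / (8 * K ^ 2) with ht
  have ht0 : 0 < t := by positivity
  have htK : t * (K ^ 2 * r) = s * p ^ 2 / 8 * r := by rw [ht]; field_simp
  have hT : 4 * K ^ 2 / (s * p ^ 2) = 1 / (2 * t) := by rw [ht]; field_simp; norm_num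
  have young : ∀ b : ℝ, b ^ 2 ≤ K ^ 2 * r → -(s * p ^ 2 / 8 * r) - 1 / (4 * t) * f ^ 2 ≤ f * b := by
    intro b hb
    have h1 : t * b ^ 2 ≤ s * p ^ 2 / 8 * r := by
      rw [← htK]
      exact mul_le_mul_of_nonneg_left hb ht0.le
    have h2 : 0 ≤ t * (b + f / (2 * t)) ^ 2 := by positivity
    have h3 : t * (b + f / (2 * t)) ^ 2 = t * b ^ 2 + f * b + 1 / (4 * t) * f ^ 2 := by
      field_simp
      ring
    linarith
  have hh2 : h ^ 2 ≤ 2 * f ^ 2 + 2 * s ^ 2 * (K ^ 2 * r) := by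
    rw [hh]
    nlinarith [sq_nonneg (f - s * z), mul_le_mul_of_nonneg_left hz (sq_nonneg s)]
  have hk : ∀ k : ℝ, |k| ≤ K → -(K * (2 * f ^ 2 + 2 * s ^ 2 * (K ^ 2 * r))) ≤ h ^ 2 * k := by
    intro k hk
    have h1 := mul_le_mul_of_nonneg_left (neg_le_of_abs_le hk) (sq_nonneg h)
    have h2 := mul_le_mul_of_nonneg_left hh2 hK.le
    linarith
  have c1 := young l hl
  have c2 := hk k₁ hk₁
  have c3 : -(K * (2 * f ^ 2 + 2 * s ^ 2 * (K ^ 2 * r))) ≤ s * h ^ 2 * k₂ := by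
    have h1 := hk k₂ hk₂
    have h2 : 0 ≤ K * (2 * f ^ 2 + 2 * s ^ 2 * (K ^ 2 * r)) := by positivity
    have h3 := mul_le_mul_of_nonneg_left h1 hs.le
    nlinarith
  have c4 : -(s * p ^ 2 / 8 * r) - 1 / (4 * t) * f ^ 2 - s ^ 2 * (K ^ 2 * r) ≤ s * h * l' := by
    have h0 : (s * l') ^ 2 ≤ K ^ 2 * r := by
      rw [mul_pow]
      exact (mul_le_of_le_one_left (sq_nonneg _) (pow_le_one₀ hs.le hs1)).trans hl'
    have h1 := young (s * l') h0
    have h4 : s * h * l' = f * (s * l') + s ^ 2 * (z * l') := by rw [hh]; ring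
    have h2 : -(K ^ 2 * r) ≤ z * l' := by nlinarith [sq_nonneg (z + l')]
    have h3 := mul_le_mul_of_nonneg_left h2 (sq_nonneg s)
    rw [h4]
    linarith
  have c5 := mul_le_mul_of_nonneg_left hM hs.le
  have c6 := mul_le_mul_of_nonneg_left hsK (mul_nonneg hs.le hr)
  have c7 : 1 / (2 * t) * f ^ 2 = 2 * (1 / (4 * t) * f ^ 2) := by field_simp; ring
  rw [hT, sub_le_iff_le_add, add_mul, c7]
  linarith

/-- Exact one-step change of the Lyapunov function under w₁ ↦ w₁ + h y₂, w₂ ↦ w₂ - h y₁, where h = f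
+ s g x. The correction built from the dᵢ is designed so that, at order s, each g yᵢyⱼ appears only
through its mean plus a coboundary error. -/
theorem lyapunov_increment_eq (p q s w₁ w₂ y₁ y₂ g f d₁ d₂ d₃ d₁' d₂' d₃' : ℝ) :
    s * (w₁ ^ 2 * (2 * p ^ 2 + 2 * p * (d₂' - d₂ + g * (y₁ * y₂) - p) -
            q * (d₁' - d₁ + g * y₁ ^ 2)) +
          w₁ * w₂ * (2 * p * q + 2 * p * ((d₁' - d₁ + g * y₁ ^ 2) +
            (d₃' - d₃ + g * y₂ ^ 2 - q))) +
          w₂ ^ 2 * (2 * p ^ 2 + q ^ 2 + 2 * p * (d₂' - d₂ + g * (y₁ * y₂) - p) +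
            q * (d₃' - d₃ + g * y₂ ^ 2 - q))) +
        f * ((2 * p * y₂ - q * y₁) * w₁ + (2 * p * y₁ + q * y₂) * w₂) +
        (f + s * (g * (y₁ * w₁ + y₂ * w₂))) ^ 2 *
          (p * (y₂ * y₂) - q * (y₁ * y₂) - p * (y₁ * y₁)) +
        s * (f + s * (g * (y₁ * w₁ + y₂ * w₂))) *
          ((2 * ((2 * p * d₂' - q * d₁') * y₂) - 2 * p * (d₁' + d₃') * y₁) * w₁ +
            (2 * p * (d₁' + d₃') * y₂ - 2 * ((2 * p * d₂' + q * d₃') * y₁)) * w₂) +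
        s * (f + s * (g * (y₁ * w₁ + y₂ * w₂))) ^ 2 *
          ((2 * p * d₂' - q * d₁') * (y₂ * y₂) - 2 * p * (d₁' + d₃') * (y₁ * y₂) +
            (2 * p * d₂' + q * d₃') * (y₁ * y₁)) =
      (p * (w₁ + (f + s * (g * (y₁ * w₁ + y₂ * w₂))) * y₂) ^ 2 +
          q * ((w₁ + (f + s * (g * (y₁ * w₁ + y₂ * w₂))) * y₂) *
            (w₂ - (f + s * (g * (y₁ * w₁ + y₂ * w₂))) * y₁)) -
          p * (w₂ - (f + s * (g * (y₁ * w₁ + y₂ * w₂))) * y₁) ^ 2 +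
          s * ((2 * p * d₂' - q * d₁') * (w₁ + (f + s * (g * (y₁ * w₁ + y₂ * w₂))) * y₂) ^ 2 +
            2 * p * (d₁' + d₃') * ((w₁ + (f + s * (g * (y₁ * w₁ + y₂ * w₂))) * y₂) *
              (w₂ - (f + s * (g * (y₁ * w₁ + y₂ * w₂))) * y₁)) +
            (2 * p * d₂' + q * d₃') * (w₂ - (f + s * (g * (y₁ * w₁ + y₂ * w₂))) * y₁) ^ 2)) -
        (p * w₁ ^ 2 + q * (w₁ * w₂) - p * w₂ ^ 2 +
          s * ((2 * p * d₂ - q * d₁) * w₁ ^ 2 + 2 * p * (d₁ + d₃) * (w₁ * w₂) +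
            (2 * p * d₂ + q * d₃) * w₂ ^ 2)) := by
  generalize hh : f + s * (g * (y₁ * w₁ + y₂ * w₂)) = h
  obtain rfl : f = h - s * (g * (y₁ * w₁ + y₂ * w₂)) := by rw [← hh]; ring
  ring

/-- Hypotheses `h₁`, `h₂`, `h₃` say that g y₁², g y₁y₂, g y₂² have means 0, p, q up to bounded
coboundaries and an error ε. The first mean being 0 is what makes the averaged system triangular. -/
theorem exists_boundedBelow_of_averages {V y₁ y₂ g d₁ d₂ d₃ : ℤ → ℝ} {p q ε : ℝ}
    (bV : BddSeq V) (b₁ : BddSeq y₁) (b₂ : BddSeq y₂) (bg : BddSeq g) (bd₁ : BddSeq d₁)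
    (bd₂ : BddSeq d₂) (bd₃ : BddSeq d₃)
    (hy₁ : ∀ n, jop V y₁ n = 0) (hy₂ : ∀ n, jop V y₂ n = 0)
    (hw : ∀ n, y₁ n * y₂ (n - 1) - y₂ n * y₁ (n - 1) = 1) (hp : p ≠ 0)
    (hε : 4 * ε * (|p| + |q|) ≤ p ^ 2 / 4)
    (h₁ : ∀ n, |d₁ (n + 1) - d₁ n + g n * y₁ n ^ 2| ≤ ε)
    (h₂ : ∀ n, |d₂ (n + 1) - d₂ n + g n * (y₁ n * y₂ n) - p| ≤ ε)
    (h₃ : ∀ n, |d₃ (n + 1) - d₃ n + g n * y₂ n ^ 2 - q| ≤ ε) :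
    ∃ s₀ > 0, ∀ s ∈ Set.Ioo 0 s₀, ∃ η > 0, BoundedBelow (fun n => V n - s * g n) η := by
  let A : ℤ → ℝ := fun n => 2 * p * d₂ n - q * d₁ n
  let B : ℤ → ℝ := fun n => 2 * p * (d₁ n + d₃ n)
  let D : ℤ → ℝ := fun n => 2 * p * d₂ n + q * d₃ n
  have bA : BddSeq A := ((BddSeq.const (2 * p)).mul bd₂).sub ((BddSeq.const q).mul bd₁)
  have bB : BddSeq B := (BddSeq.const (2 * p)).mul (bd₁.add bd₃)
  have bD : BddSeq D := ((BddSeq.const (2 * p)).mul bd₂).add ((BddSeq.const q).mul bd₃)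
  let k₁ : ℤ → ℝ := fun n => p * (y₂ n * y₂ n) - q * (y₁ n * y₂ n) - p * (y₁ n * y₁ n)
  let k₂ : ℤ → ℝ := fun n =>
    A (n + 1) * (y₂ n * y₂ n) - B (n + 1) * (y₁ n * y₂ n) + D (n + 1) * (y₁ n * y₁ n)
  obtain ⟨K₁, hK₁⟩ : BddSeq k₁ :=
    (((BddSeq.const p).mul (b₂.mul b₂)).sub ((BddSeq.const q).mul (b₁.mul b₂))).sub
      ((BddSeq.const p).mul (b₁.mul b₁))
  obtain ⟨K₂, hK₂⟩ : BddSeq k₂ :=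
    (((bA.shift 1).mul (b₂.mul b₂)).sub ((bB.shift 1).mul (b₁.mul b₂))).add
      ((bD.shift 1).mul (b₁.mul b₁))
  obtain ⟨K₃, hK₃⟩ : BddSeq fun n => 2 * p * y₂ n - q * y₁ n :=
    ((BddSeq.const (2 * p)).mul b₂).sub ((BddSeq.const q).mul b₁)
  obtain ⟨K₄, hK₄⟩ : BddSeq fun n => 2 * p * y₁ n + q * y₂ n :=
    ((BddSeq.const (2 * p)).mul b₁).add ((BddSeq.const q).mul b₂)
  obtain ⟨K₅, hK₅⟩ : BddSeq fun n => 2 * (A (n + 1) * y₂ n) - B (n + 1) * y₁ n :=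
    ((BddSeq.const 2).mul ((bA.shift 1).mul b₂)).sub ((bB.shift 1).mul b₁)
  obtain ⟨K₆, hK₆⟩ : BddSeq fun n => B (n + 1) * y₂ n - 2 * (D (n + 1) * y₁ n) :=
    ((bB.shift 1).mul b₂).sub ((BddSeq.const 2).mul ((bD.shift 1).mul b₁))
  obtain ⟨K₇, hK₇⟩ : BddSeq fun n => g n * y₁ n := bg.mul b₁
  obtain ⟨K₈, hK₈⟩ : BddSeq fun n => g n * y₂ n := bg.mul b₂
  obtain ⟨C₁, hC₁⟩ := b₁
  obtain ⟨C₂, hC₂⟩ := b₂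
  have n1 := (abs_nonneg _).trans (hK₁ 0)
  have n2 := (abs_nonneg _).trans (hK₂ 0)
  have n3 := (abs_nonneg _).trans (hK₃ 0)
  have n4 := (abs_nonneg _).trans (hK₄ 0)
  have n5 := (abs_nonneg _).trans (hK₅ 0)
  have n6 := (abs_nonneg _).trans (hK₆ 0)
  have n7 := (abs_nonneg _).trans (hK₇ 0)
  have n8 := (abs_nonneg _).trans (hK₈ 0)
  have n9 := (abs_nonneg _).trans (hC₁ 0)
  have n10 := (abs_nonneg _).trans (hC₂ 0)
  set m : ℝ := K₁ + K₂ + K₃ + K₄ + K₅ + K₆ + K₇ + K₈ + C₁ + C₂ + 1 with hm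
  have hm0 : 0 < m := by positivity
  have m1 : K₁ ≤ m := by linarith only [hm, n1, n2, n3, n4, n5, n6, n7, n8, n9, n10]
  have m2 : K₂ ≤ m := by linarith only [hm, n1, n2, n3, n4, n5, n6, n7, n8, n9, n10]
  have m3 : K₃ ≤ m := by linarith only [hm, n1, n2, n3, n4, n5, n6, n7, n8, n9, n10]
  have m4 : K₄ ≤ m := by linarith only [hm, n1, n2, n3, n4, n5, n6, n7, n8, n9, n10]
  have m5 : K₅ ≤ m := by linarith only [hm, n1, n2, n3, n4, n5, n6, n7, n8, n9, n10]
  have m6 : K₆ ≤ m := by linarith only [hm, n1, n2, n3, n4, n5, n6, n7, n8, n9, n10]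
  have m7 : K₇ ≤ m := by linarith only [hm, n1, n2, n3, n4, n5, n6, n7, n8, n9, n10]
  have m8 : K₈ ≤ m := by linarith only [hm, n1, n2, n3, n4, n5, n6, n7, n8, n9, n10]
  have m9 : C₁ ≤ m := by linarith only [hm, n1, n2, n3, n4, n5, n6, n7, n8, n9, n10]
  have m10 : C₂ ≤ m := by linarith only [hm, n1, n2, n3, n4, n5, n6, n7, n8, n9, n10]
  clear_value m
  -- Dominates both m and √2 m; the latter arises from squaring a sum of two terms.
  set K : ℝ := 2 * m with hK
  have hK0 : 0 < K := by positivity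
  have hKm : 2 * m ^ 2 ≤ K ^ 2 := by
    rw [hK, mul_pow]
    linarith only [sq_nonneg m]
  have hmK : m ≤ K := by linarith only [hK, hm0]
  clear_value K
  have hp2 : 0 < p ^ 2 := by positivity
  refine ⟨min 1 (p ^ 2 / 4 / (4 * K ^ 3 + K ^ 2)), by positivity, fun s hs => ?_⟩
  have hs0 : 0 < s := hs.1
  have hs1 : s ≤ 1 := (hs.2.trans_le (min_le_left _ _)).le
  have hsK : s * (4 * K ^ 3 + K ^ 2) ≤ p ^ 2 / 4 := by
    have := (hs.2.trans_le (min_le_right _ _)).le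
    rwa [le_div_iff₀ (by positivity)] at this
  set T : ℝ := 4 * K + 4 * K ^ 2 / (s * p ^ 2) with hT
  have hT0 : 0 < T := by positivity
  -- Since x² ≤ 2m²(w₁² + w₂²), this converts the gain in w into a gain in x.
  set c : ℝ := s * p ^ 2 / 4 / (2 * m ^ 2) with hc
  have hc0 : 0 < c := by positivity
  refine ⟨Real.sqrt (c / T), Real.sqrt_pos.2 (by positivity), fun x hx => ?_⟩
  rw [Real.sq_sqrt (by positivity)]
  -- Variation of constants: the coefficients of x in the basis y₁, y₂, by Cramer's rule with
  -- Wronskian one.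
  let w₁ : ℤ → ℝ := fun n => y₂ (n - 1) * x n - y₂ n * x (n - 1)
  let w₂ : ℤ → ℝ := fun n => y₁ n * x (n - 1) - y₁ (n - 1) * x n
  let f : ℤ → ℝ := fun n => jop (fun n => V n - s * g n) x n
  let L : ℤ → ℝ := fun n => p * w₁ n ^ 2 + q * (w₁ n * w₂ n) - p * w₂ n ^ 2 +
    s * (A n * w₁ n ^ 2 + B n * (w₁ n * w₂ n) + D n * w₂ n ^ 2)
  have xw : ∀ n, x n = y₁ n * w₁ n + y₂ n * w₂ n := fun n => by
    simp only [w₁, w₂]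
    linear_combination (-x n) * hw n
  have step₁ : ∀ n, w₁ (n + 1) = w₁ n + (f n + s * (g n * x n)) * y₂ n := fun n => by
    have := hy₂ n
    simp only [jop] at this
    simp only [w₁, f, jop, add_sub_cancel_right]
    linear_combination (-x n) * this
  have step₂ : ∀ n, w₂ (n + 1) = w₂ n - (f n + s * (g n * x n)) * y₁ n := fun n => by
    have := hy₁ n
    simp only [jop] at this
    simp only [w₂, f, jop, add_sub_cancel_right]
    linear_combination (x n) * this
  have incr : ∀ n, c * x n ^ 2 - T * f n ^ 2 ≤ L (n + 1) - L n := by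
    intro n
    have sq2 : ∀ {α β : ℝ}, |α| ≤ m → |β| ≤ m →
        (α * w₁ n + β * w₂ n) ^ 2 ≤ K ^ 2 * (w₁ n ^ 2 + w₂ n ^ 2) := fun hα hβ =>
      (sq_linear_le hα hβ).trans (mul_le_mul_of_nonneg_right hKm
        (add_nonneg (sq_nonneg _) (sq_nonneg _)))
    have key := lyapunov_increment_ge (p := p) (K := K) (s := s) (r := w₁ n ^ 2 + w₂ n ^ 2)
      (f := f n) (h := f n + s * (g n * x n)) (k₁ := k₁ n) (k₂ := k₂ n)
      (l := (2 * p * y₂ n - q * y₁ n) * w₁ n + (2 * p * y₁ n + q * y₂ n) * w₂ n)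
      (l' := (2 * (A (n + 1) * y₂ n) - B (n + 1) * y₁ n) * w₁ n +
        (B (n + 1) * y₂ n - 2 * (D (n + 1) * y₁ n)) * w₂ n)
      (z := g n * x n) hp hK0 hs0 hs1 hsK
      (averaged_form_ge hε (h₁ n) (h₂ n) (h₃ n) (w₁ n) (w₂ n))
      (sq2 ((hK₃ n).trans m3) ((hK₄ n).trans m4))
      (sq2 ((hK₅ n).trans m5) ((hK₆ n).trans m6))
      (by
        rw [xw, mul_add, ← mul_assoc, ← mul_assoc]
        exact sq2 ((hK₇ n).trans m7) ((hK₈ n).trans m8))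
      rfl ((hK₁ n).trans (m1.trans hmK)) ((hK₂ n).trans (m2.trans hmK))
    have hx2 : c * x n ^ 2 ≤ s * p ^ 2 / 4 * (w₁ n ^ 2 + w₂ n ^ 2) := by
      have := sq_linear_le (w₁ := w₁ n) (w₂ := w₂ n) ((hC₁ n).trans m9)
        ((hC₂ n).trans m10)
      rw [← xw] at this
      rw [hc, div_mul_eq_mul_div, div_le_iff₀ (by positivity)]
      have h0 : 0 ≤ s * p ^ 2 / 4 := by positivity
      calc s * p ^ 2 / 4 * x n ^ 2 ≤ s * p ^ 2 / 4 * (2 * m ^ 2 * (w₁ n ^ 2 + w₂ n ^ 2)) :=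
            mul_le_mul_of_nonneg_left this h0
        _ = _ := by ring
    refine (sub_le_sub_right hx2 _).trans (key.trans (le_of_eq ?_))
    have e := lyapunov_increment_eq p q s (w₁ n) (w₂ n) (y₁ n) (y₂ n) (g n) (f n)
      (d₁ n) (d₂ n) (d₃ n) (d₁ (n + 1)) (d₂ (n + 1)) (d₃ (n + 1))
    rw [← xw, ← step₁, ← step₂] at e
    exact e
  have hx1 : Summable fun n => x (n - 1) ^ 2 :=
    summable_shift_sub (f := fun i => x i ^ 2) hx
  have b₁ : BddSeq y₁ := ⟨C₁, hC₁⟩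
  have b₂ : BddSeq y₂ := ⟨C₂, hC₂⟩
  have b₁' : BddSeq fun n => y₁ (n - 1) := b₁.shift (-1)
  have b₂' : BddSeq fun n => y₂ (n - 1) := b₂.shift (-1)
  have sx : Summable fun n => x n * x (n - 1) := summable_mul_of_sq hx hx1
  have sw₁ : Summable fun n => w₁ n ^ 2 := by
    refine ((((b₂'.mul b₂').mul_summable hx).add ((b₂.mul b₂).mul_summable hx1)).sub
      ((((BddSeq.const 2).mul (b₂'.mul b₂))).mul_summable sx)).congr fun n => ?_
    simp only [w₁]
    ring
  have sw₂ : Summable fun n => w₂ n ^ 2 := by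
    refine ((((b₁'.mul b₁').mul_summable hx).add ((b₁.mul b₁).mul_summable hx1)).sub
      ((((BddSeq.const 2).mul (b₁'.mul b₁))).mul_summable sx)).congr fun n => ?_
    simp only [w₂]
    ring
  have sw := summable_mul_of_sq sw₁ sw₂
  have sL : Summable L :=
    (((sw₁.mul_left p).add (sw.mul_left q)).sub (sw₂.mul_left p)).add
      ((((bA.mul_summable sw₁).add (bB.mul_summable sw)).add (bD.mul_summable sw₂)).mul_left s)
  have sL' : Summable fun n => L (n + 1) := summable_shift sL
  obtain ⟨C, hC⟩ : BddSeq fun n => V n - s * g n := bV.sub ((BddSeq.const s).mul bg)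
  have sf : Summable fun n => f n ^ 2 := summable_jop_sq hC hx
  -- The increments of the summable function L add up to zero, leaving c Σ x² ≤ T Σ f².
  have total := Summable.tsum_le_tsum incr ((hx.mul_left c).sub (sf.mul_left T)) (sL'.sub sL)
  rw [(hx.mul_left c).tsum_sub (sf.mul_left T), sL'.tsum_sub sL, tsum_mul_left, tsum_mul_left,
    show ∑' n, L (n + 1) = ∑' n, L n from tsum_shift L, sub_self] at total
  rw [div_mul_eq_mul_div, div_le_iff₀ hT0]
  change c * ∑' i, x i ^ 2 ≤ (∑' i, f i ^ 2) * T
  linarith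


/-! ### Averages and approximate coboundaries -/

open MeasureTheory

/-- The mean value of a function on the circle. -/
def avg (F : C(Torus, ℝ)) : ℝ := ∫ θ, F θ ∂(AddCircle.haarAddCircle : Measure Torus)

theorem integrable_haar {𝕜 : Type*} [NormedAddCommGroup 𝕜] (F : C(Torus, 𝕜)) :
    Integrable F (AddCircle.haarAddCircle : Measure Torus) := by
  rw [← integrableOn_univ]
  exact F.continuous.continuousOn.integrableOn_compact isCompact_univ

theorem avg_add (F G : C(Torus, ℝ)) : avg (F + G) = avg F + avg G :=
  integral_add (integrable_haar F) (integrable_haar G)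

theorem avg_sub (F G : C(Torus, ℝ)) : avg (F - G) = avg F - avg G :=
  integral_sub (integrable_haar F) (integrable_haar G)

theorem avg_smul (c : ℝ) (F : C(Torus, ℝ)) : avg (c • F) = c * avg F :=
  integral_const_mul c F

theorem avg_sq_pos {F : C(Torus, ℝ)} (hF : F ≠ 0) : 0 < avg (F * F) := by
  obtain ⟨θ, hθ⟩ := DFunLike.ne_iff.1 hF
  refine (F * F).continuous.integral_pos_of_hasCompactSupport_nonneg_nonzero
    (HasCompactSupport.of_compactSpace _) (fun x => mul_self_nonneg (F x)) (x := θ) ?_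
  simpa using hθ

theorem norm_integral_haar_le (F : C(Torus, ℂ)) {ε : ℝ} (h : ∀ θ, ‖F θ‖ ≤ ε) :
    ‖∫ θ, F θ ∂(AddCircle.haarAddCircle : Measure Torus)‖ ≤ ε := by
  simpa using norm_integral_le_of_norm_le_const (Eventually.of_forall h)
    (μ := (AddCircle.haarAddCircle : Measure Torus))

theorem fourier_apply_add (n : ℤ) (θ α : Torus) :
    fourier n (θ + α) = fourier n θ * fourier n α := by
  simp only [fourier_apply, smul_add, AddCircle.toCircle_add, Circle.coe_mul]

theorem fourier_rot_ne_one {ω : ℝ} (hω : ∀ k : ℤ, k ≠ 0 → k • rot ω ≠ 0) {n : ℤ} (hn : n ≠ 0) :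
    fourier n (rot ω) ≠ (1 : ℂ) := by
  intro h
  apply hω n hn
  apply AddCircle.injective_toCircle Real.two_pi_pos.ne'
  rw [AddCircle.toCircle_zero]
  rw [fourier_apply] at h
  exact Circle.ext (by simpa using h)

/-- For trigonometric polynomials the equation is solved exactly, the divisors being merely nonzero.
In general F is approximated by such a G, and F - G and its mean each contribute ε/2. -/
theorem exists_approx_coboundary_complex {ω : ℝ} (hω : ∀ k : ℤ, k ≠ 0 → k • rot ω ≠ 0)
    (F : C(Torus, ℂ)) {ε : ℝ} (hε : 0 < ε) : ∃ d : C(Torus, ℂ), ∀ θ,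
      ‖d (θ + rot ω) - d θ + F θ -
        ∫ x, F x ∂(AddCircle.haarAddCircle : Measure Torus)‖ ≤ ε := by
  have exact_span : ∀ F ∈ Submodule.span ℂ (Set.range (@fourier (2 * Real.pi))),
      ∃ d : C(Torus, ℂ), ∀ θ, d (θ + rot ω) - d θ + F θ -
        ∫ x, F x ∂(AddCircle.haarAddCircle : Measure Torus) = 0 := by
    intro F hF
    induction hF using Submodule.span_induction with
    | mem F hF =>
      obtain ⟨n, rfl⟩ := hF
      by_cases hn : n = 0
      · subst hn
        exact ⟨0, fun θ => by simp⟩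
      · have hc := fourier_rot_ne_one hω hn
        have hc' : fourier n (rot ω) - (1 : ℂ) ≠ 0 := sub_ne_zero.2 hc
        have h0 : ∫ x, fourier n x ∂(AddCircle.haarAddCircle : Measure Torus) = (0 : ℂ) := by
          -- Translation invariance multiplies the mean by the value of the character at the
          -- rotation, which is not 1.
          have h1 := integral_add_right_eq_self
            (μ := (AddCircle.haarAddCircle : Measure Torus)) (fun x => fourier n x) (rot ω)
          simp only [fourier_apply_add] at h1
          rw [integral_mul_const] at h1
          refine (mul_eq_zero.1 ?_).resolve_right hc'
          rw [mul_sub, h1, mul_one, sub_self]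
        refine ⟨(-(fourier n (rot ω) - (1 : ℂ))⁻¹) • fourier n, fun θ => ?_⟩
        rw [h0]
        simp only [ContinuousMap.coe_smul, Pi.smul_apply, smul_eq_mul, fourier_apply_add]
        field_simp
        ring
    | zero => exact ⟨0, fun θ => by simp⟩
    | add F G _ _ hF hG =>
      obtain ⟨d, hd⟩ := hF
      obtain ⟨e, he⟩ := hG
      refine ⟨d + e, fun θ => ?_⟩
      simp only [ContinuousMap.add_apply]
      rw [integral_add (integrable_haar F) (integrable_haar G)]
      linear_combination hd θ + he θ
    | smul c F _ hF =>
      obtain ⟨d, hd⟩ := hF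
      refine ⟨c • d, fun θ => ?_⟩
      simp only [ContinuousMap.smul_apply, smul_eq_mul]
      rw [integral_const_mul]
      linear_combination c * hd θ
  have hmem : F ∈ (Submodule.span ℂ (Set.range (@fourier (2 * Real.pi)))).topologicalClosure := by
    rw [span_fourier_closure_eq_top]
    trivial
  obtain ⟨G, hG, hFG⟩ := Metric.mem_closure_iff.1 hmem (ε / 2) (half_pos hε)
  obtain ⟨d, hd⟩ := exact_span G hG
  refine ⟨d, fun θ => ?_⟩
  have hb : ∀ θ, ‖(F - G) θ‖ ≤ ε / 2 := fun θ => by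
    refine ((F - G).norm_coe_le_norm θ).trans ?_
    rw [← dist_eq_norm]
    exact hFG.le
  have e : d (θ + rot ω) - d θ + F θ - ∫ x, F x ∂(AddCircle.haarAddCircle : Measure Torus) =
      (F - G) θ - ∫ x, (F - G) x ∂(AddCircle.haarAddCircle : Measure Torus) := by
    simp only [ContinuousMap.sub_apply]
    rw [integral_sub (integrable_haar F) (integrable_haar G)]
    linear_combination hd θ
  rw [e]
  refine (norm_sub_le _ _).trans ?_
  linarith [hb θ, norm_integral_haar_le (F - G) hb]

theorem exists_approx_coboundary {ω : ℝ} (hω : ∀ k : ℤ, k ≠ 0 → k • rot ω ≠ 0)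
    (F : C(Torus, ℝ)) {ε : ℝ} (hε : 0 < ε) : ∃ d : C(Torus, ℝ), ∀ θ,
      |d (θ + rot ω) - d θ + F θ - avg F| ≤ ε := by
  obtain ⟨d, hd⟩ := exists_approx_coboundary_complex hω
    ⟨fun θ => (F θ : ℂ), Complex.continuous_ofReal.comp F.continuous⟩ hε
  refine ⟨⟨fun θ => (d θ).re, Complex.continuous_re.comp d.continuous⟩, fun θ => ?_⟩
  refine (le_of_eq ?_).trans ((Complex.abs_re_le_norm _).trans (hd θ))
  simp only [ContinuousMap.coe_mk, integral_complex_ofReal]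
  simp [avg]

/-! ### Floquet solutions -/

/-- `z₁, z₂` generate quasi-periodic solutions of `H_V y = a y` with Wronskian one. -/
structure IsFloquetPair (V : C(Torus, ℝ)) (ω a : ℝ) (z₁ z₂ : C(Torus, ℝ)) : Prop where
  eq₁ : ∀ θ, z₁ (θ + rot ω) + z₁ (θ - rot ω) = (a - V θ) * z₁ θ
  eq₂ : ∀ θ, z₂ (θ + rot ω) + z₂ (θ - rot ω) = (a - V θ) * z₂ θ
  wronskian : ∀ θ, z₁ θ * z₂ (θ - rot ω) - z₂ θ * z₁ (θ - rot ω) = 1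

theorem IsRealAnalytic.continuous {f : Torus → ℝ} (hf : IsRealAnalytic f) : Continuous f := by
  refine continuous_coinduced_dom.mpr ?_
  exact continuous_iff_continuousAt.2 fun t => (hf t (Set.mem_univ t)).continuousAt

/-- The second row of Z is the first translated back by the rotation. Hence the entries of the first
row solve the second-order equation, and det Z is their Wronskian. -/
theorem exists_isFloquetPair {V : C(Torus, ℝ)} {ω a : ℝ}
    (h : AnalyticallyReducibleTo (cocycle a V) ω 1) : ∃ z₁ z₂ : C(Torus, ℝ),
      IsRealAnalytic z₁ ∧ IsRealAnalytic z₂ ∧ IsFloquetPair V ω a z₁ z₂ := by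
  obtain ⟨Z, hZ, hA⟩ := h
  have hmat : ∀ θ, (Z (θ + rot ω) : Matrix (Fin 2) (Fin 2) ℝ) =
      !![a - V θ, -1; 1, 0] * (Z θ : Matrix (Fin 2) (Fin 2) ℝ) := by
    intro θ
    have := congrArg Subtype.val (hA θ)
    rw [mul_one] at this
    exact this.symm
  have row0 : ∀ j θ, Z (θ + rot ω) 0 j = (a - V θ) * Z θ 0 j - Z θ 1 j := by
    intro j θ
    have := congrFun (congrFun (hmat θ) 0) j
    rw [Matrix.mul_apply, Fin.sum_univ_two] at this
    refine this.trans ?_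
    simp
    ring
  have row1 : ∀ j θ, Z (θ + rot ω) 1 j = Z θ 0 j := by
    intro j θ
    have := congrFun (congrFun (hmat θ) 1) j
    rw [Matrix.mul_apply, Fin.sum_univ_two] at this
    refine this.trans ?_
    simp
  have row1' : ∀ j θ, Z θ 1 j = Z (θ - rot ω) 0 j := by
    intro j θ
    have := row1 j (θ - rot ω)
    rwa [sub_add_cancel] at this
  refine ⟨⟨fun θ => Z θ 0 0, (hZ 0 0).continuous⟩, ⟨fun θ => Z θ 0 1, (hZ 0 1).continuous⟩,
    hZ 0 0, hZ 0 1, ?_, ?_, ?_⟩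
  · intro θ
    simp only [ContinuousMap.coe_mk]
    rw [row0, ← row1' 0 θ]
    ring
  · intro θ
    simp only [ContinuousMap.coe_mk]
    rw [row0, ← row1' 1 θ]
    ring
  · intro θ
    simp only [ContinuousMap.coe_mk]
    rw [← row1', ← row1', ← Matrix.det_fin_two]
    exact (Z θ).2

theorem bddSeq_site (V : C(Torus, ℝ)) (ω : ℝ) (φ : Torus) : BddSeq (site V ω φ) :=
  ⟨‖V‖, abs_site_le V ω φ⟩

theorem site_add_one (V : C(Torus, ℝ)) (ω : ℝ) (φ : Torus) (n : ℤ) :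
    site V ω φ (n + 1) = V (n • rot ω + φ + rot ω) := by
  rw [site_eq, add_zsmul, one_zsmul]
  congr 1
  abel

theorem site_sub_one (V : C(Torus, ℝ)) (ω : ℝ) (φ : Torus) (n : ℤ) :
    site V ω φ (n - 1) = V (n • rot ω + φ - rot ω) := by
  rw [site_eq, sub_zsmul, one_zsmul]
  congr 1
  abel

section

variable {V z₁ z₂ : C(Torus, ℝ)} {ω a : ℝ}

theorem IsFloquetPair.jop₁ (h : IsFloquetPair V ω a z₁ z₂) (φ : Torus) (n : ℤ) :
    jop (fun i => site V ω φ i - a) (site z₁ ω φ) n = 0 := by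
  have := h.eq₁ (n • rot ω + φ)
  rw [jop, site_add_one, site_sub_one, site_eq, site_eq]
  linarith

theorem IsFloquetPair.jop₂ (h : IsFloquetPair V ω a z₁ z₂) (φ : Torus) (n : ℤ) :
    jop (fun i => site V ω φ i - a) (site z₂ ω φ) n = 0 := by
  have := h.eq₂ (n • rot ω + φ)
  rw [jop, site_add_one, site_sub_one, site_eq, site_eq]
  linarith

/-- If the averaged first order perturbation is hyperbolic, the perturbed operators have a
resolvent energy near `a`. -/
theorem IsFloquetPair.exists_boundedBelow_path (h : IsFloquetPair V ω a z₁ z₂)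
    (hω : ∀ k : ℤ, k ≠ 0 → k • rot ω ≠ 0) (hz : avg (z₁ * z₁) ≠ 0) {U : C(Torus, ℝ)}
    (hU : avg (U * (z₁ * z₂)) * avg (z₁ * z₁) ≠ avg (U * (z₁ * z₁)) * avg (z₁ * z₂)) :
    ∃ μ : ℝ, ∃ s₀ > 0, ∀ s ∈ Set.Ioo 0 s₀, ∃ η > 0,
      BoundedBelow (fun i => site (V + s • U) ω 0 i - (a + s * μ)) η := by
  -- The energy slope for which (μ - U) z₁² has mean zero.
  set μ := avg (U * (z₁ * z₁)) / avg (z₁ * z₁) with hμ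
  have expand : ∀ F : C(Torus, ℝ), avg ((ContinuousMap.const Torus μ - U) * F) =
      μ * avg F - avg (U * F) := by
    intro F
    rw [sub_mul, avg_sub, ← avg_smul]
    rfl
  set g : C(Torus, ℝ) := ContinuousMap.const Torus μ - U with hg
  set p := avg (g * (z₁ * z₂)) with hp
  set q := avg (g * (z₂ * z₂)) with hq
  have hr : avg (g * (z₁ * z₁)) = 0 := by
    rw [expand, hμ, div_mul_cancel₀ _ hz, sub_self]
  -- Multiplying p by the mean of z₁² gives the difference of the two sides of `hU`, up to sign.
  have hp0 : p ≠ 0 := by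
    rw [hp, expand, hμ]
    intro h0
    apply hU
    field_simp at h0
    linarith
  have hpq : 0 < |p| + |q| := add_pos_of_pos_of_nonneg (abs_pos.2 hp0) (abs_nonneg _)
  set ε : ℝ := p ^ 2 / (16 * (|p| + |q|)) with hε
  have hε0 : 0 < ε := by positivity
  obtain ⟨d₁, hd₁⟩ := exists_approx_coboundary hω (g * (z₁ * z₁)) hε0
  obtain ⟨d₂, hd₂⟩ := exists_approx_coboundary hω (g * (z₁ * z₂)) hε0
  obtain ⟨d₃, hd₃⟩ := exists_approx_coboundary hω (g * (z₂ * z₂)) hε0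
  obtain ⟨s₀, hs₀, hs⟩ := exists_boundedBelow_of_averages
    (V := fun i => site V ω 0 i - a) (y₁ := site z₁ ω 0) (y₂ := site z₂ ω 0) (g := site g ω 0)
    (d₁ := site d₁ ω 0) (d₂ := site d₂ ω 0) (d₃ := site d₃ ω 0) (p := p) (q := q) (ε := ε)
    ((bddSeq_site V ω 0).sub (BddSeq.const a)) (bddSeq_site _ _ _) (bddSeq_site _ _ _)
    (bddSeq_site _ _ _) (bddSeq_site _ _ _) (bddSeq_site _ _ _) (bddSeq_site _ _ _)
    (h.jop₁ 0) (h.jop₂ 0)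
    (fun n => by
      rw [site_sub_one, site_sub_one, site_eq, site_eq]
      exact h.wronskian _)
    hp0
    (by
      rw [hε]
      field_simp
      linarith)
    (fun n => by
      have := hd₁ (n • rot ω + 0)
      rw [hr, sub_zero] at this
      rw [site_add_one, site_eq, site_eq, site_eq, sq]
      exact this)
    (fun n => by
      rw [site_add_one, site_eq, site_eq, site_eq, site_eq]
      exact hd₂ (n • rot ω + 0))
    (fun n => by
      rw [site_add_one, site_eq, site_eq, site_eq, sq]
      exact hd₃ (n • rot ω + 0))
  refine ⟨μ, s₀, hs₀, fun s hs' => ?_⟩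
  obtain ⟨η, hη, hB⟩ := hs s hs'
  refine ⟨η, hη, ?_⟩
  have e : (fun i => site (V + s • U) ω 0 i - (a + s * μ)) =
      fun n => site V ω 0 n - a - s * site g ω 0 n := by
    ext i
    rw [site_add_smul, show site g ω 0 i = μ - site U ω 0 i from rfl]
    ring
  rwa [e]

end


/-! ### Spectrum on both sides of the reducible energy -/

/-- Sturm oscillation: if y first became nonpositive at k + 1, cutting it there and putting a small
t > 0 at k + 1 would give a test sequence with positive form. Only the sites k and k + 1 contribute.
-/
theorem pos_of_jform_nonpos {v y : ℤ → ℝ} (hv : ∀ x : ℤ →₀ ℝ, jform v x ≤ 0)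
    (hy : ∀ n, jop v y n = 0) (h0 : y 0 = 0) (h1 : y 1 = 1) (m : ℕ) : 0 < y (m + 1) := by
  induction m with
  | zero => simp [h1]
  | succ m ih =>
    by_contra! hcon
    push_cast at hcon
    set k : ℤ := m + 1 with hk
    have hk1 : 1 ≤ k := by omega
    -- Small enough that |v (k + 1)| t ≤ y k, so the last site contributes nonnegatively.
    set t : ℝ := y k / (|v (k + 1)| + 1) with ht
    have ht0 : 0 < t := by positivity
    let X : ℤ → ℝ := fun i => if 1 ≤ i ∧ i ≤ k then y i else if i = k + 1 then t else 0
    have hX : ∀ i, X i ≠ 0 → i ∈ Finset.Icc 1 (k + 1) := by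
      intro i hi
      by_contra hn
      rw [Finset.mem_Icc] at hn
      apply hi
      simp only [X]
      rw [if_neg (by omega), if_neg (by omega)]
    have e1 : ∀ i, 0 ≤ i → i ≤ k → X i = y i := by
      intro i hi0 hik
      simp only [X]
      by_cases h : 1 ≤ i
      · rw [if_pos ⟨h, hik⟩]
      · obtain rfl : i = 0 := by omega
        rw [if_neg (by omega), if_neg (by omega), h0]
    have e2 : X (k + 1) = t := by
      simp only [X]
      rw [if_neg (by omega)]
      simp
    have e3 : X (k + 2) = 0 := by
      simp only [X]
      rw [if_neg (by omega), if_neg (by omega)]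
    set x : ℤ →₀ ℝ := Finsupp.onFinset (Finset.Icc 1 (k + 1)) X hX with hx
    have hxX : ⇑x = X := rfl
    have key : jform v x = X k * jop v X k + X (k + 1) * jop v X (k + 1) := by
      have a1 : jform v x = ∑ i ∈ Finset.Icc 1 (k + 1), X i * jop v X i := by
        rw [jform, hxX]
        refine Finset.sum_subset Finsupp.support_onFinset_subset fun i _ hi => ?_
        rw [Finsupp.notMem_support_iff, hxX] at hi
        rw [hi, zero_mul]
      have a2 : ∑ i ∈ ({k, k + 1} : Finset ℤ), X i * jop v X i =
          ∑ i ∈ Finset.Icc 1 (k + 1), X i * jop v X i := by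
        refine Finset.sum_subset (fun i hi => ?_) fun i hi hi' => ?_
        · simp only [Finset.mem_insert, Finset.mem_singleton] at hi
          rw [Finset.mem_Icc]
          omega
        · simp only [Finset.mem_insert, Finset.mem_singleton] at hi'
          rw [Finset.mem_Icc] at hi
          have : jop v X i = jop v y i := by
            rw [jop, jop, e1 i (by omega) (by omega), e1 (i + 1) (by omega) (by omega),
              e1 (i - 1) (by omega) (by omega)]
          rw [this, hy, mul_zero]
      rw [a1, ← a2, Finset.sum_pair (by omega)]
    have hyk := hy k
    have b1 : jop v X k = t - y (k + 1) := by
      rw [jop] at hyk ⊢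
      rw [e2, e1 k (by omega) le_rfl, e1 (k - 1) (by omega) (by omega)]
      linarith
    have b2 : jop v X (k + 1) = y k + v (k + 1) * t := by
      rw [jop, e2, add_sub_cancel_right, e1 k (by omega) le_rfl,
        show k + 1 + 1 = k + 2 by ring, e3]
      ring
    have hle := hv x
    rw [key, b1, b2, e1 k (by omega) le_rfl, e2] at hle
    have c1 : |v (k + 1)| * t ≤ y k := by
      have : (|v (k + 1)| + 1) * t = y k := by
        rw [ht]
        field_simp
      linarith
    have c2 : -(|v (k + 1)| * t) ≤ v (k + 1) * t := by
      have := mul_le_mul_of_nonneg_right (neg_abs_le (v (k + 1))) ht0.le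
      linarith
    have c3 : 0 < t * y k := mul_pos ht0 ih
    have c4 : 0 ≤ t * (y k + v (k + 1) * t) := mul_nonneg ht0.le (by linarith)
    have c5 : 0 ≤ y k * -y (k + 1) := mul_nonneg ih.le (by linarith)
    linarith

/-- Recurrence by compactness: two multiples of α are close, and so is their difference to 0.
Indices two apart in the subsequence make the multiplier at least 2, which keeps the site just
before the return positive. -/
theorem exists_nsmul_mem_nhds_zero (α : Torus) {S : Set Torus} (hS : S ∈ 𝓝 0) :
    ∃ n : ℕ, (((n + 2 : ℕ) : ℤ) • α) ∈ S := by
  obtain ⟨δ, hδ, hball⟩ := Metric.mem_nhds_iff.1 hS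
  obtain ⟨x, -, φ, hφ, hlim⟩ := isCompact_univ.tendsto_subseq
    (x := fun n : ℕ => (n : ℤ) • α) fun _ => Set.mem_univ _
  obtain ⟨N, hN⟩ := Metric.cauchySeq_iff.1 hlim.cauchySeq δ hδ
  have h1 := hN (N + 2) (by omega) N le_rfl
  have h2 : φ N + 2 ≤ φ (N + 2) := by
    have a1 := hφ (Nat.lt_succ_self N)
    have a2 := hφ (Nat.lt_succ_self (N + 1))
    simp only [Nat.succ_eq_add_one] at a1 a2
    rw [show N + 1 + 1 = N + 2 by ring] at a2
    omega
  refine ⟨φ (N + 2) - φ N - 2, hball ?_⟩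
  rw [Metric.mem_ball, dist_zero_right]
  simp only [Function.comp_apply] at h1
  rw [dist_eq_norm] at h1
  have h3 : ((φ (N + 2) - φ N - 2 + 2 : ℕ) : ℤ) = (φ (N + 2) : ℤ) - φ N := by omega
  rwa [h3, sub_zsmul, ← sub_eq_add_neg]

section

variable {V z₁ z₂ : C(Torus, ℝ)} {ω a : ℝ}

/-- The solution of `H y = a y` with `y 0 = 0`, `y 1 = 1` changes sign under recurrence. -/
theorem IsFloquetPair.exists_recurrent_solution (h : IsFloquetPair V ω a z₁ z₂) :
    ∃ y : ℤ → ℝ, (∀ n, jop (fun i => site V ω 0 i - a) y n = 0) ∧ y 0 = 0 ∧ y 1 = 1 ∧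
      ∃ n : ℕ, y (n + 1) < 0 ∧ 0 < y (n + 3) := by
  -- Vanishes at 0 and, by the Wronskian and the equation, equals -1 and 1 at the two neighbours. A
  -- close return to 0 reproduces these signs.
  let F : C(Torus, ℝ) := z₂ 0 • z₁ - z₁ 0 • z₂
  have hF : ∀ θ, F θ = z₂ 0 * z₁ θ - z₁ 0 * z₂ θ := fun _ => rfl
  have hsite : ∀ n, site F ω 0 n = z₂ 0 * site z₁ ω 0 n - z₁ 0 * site z₂ ω 0 n := fun _ => rfl
  have hjop : ∀ n, jop (fun i => site V ω 0 i - a) (site F ω 0) n = 0 := by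
    intro n
    have j1 := h.jop₁ 0 n
    have j2 := h.jop₂ 0 n
    simp only [jop, hsite] at j1 j2 ⊢
    linear_combination z₂ 0 * j1 - z₁ 0 * j2
  have hF0 : F 0 = 0 := by rw [hF]; ring
  have hFm : F (0 - rot ω) = -1 := by
    have := h.wronskian 0
    rw [hF]
    linarith
  have hFp : F (0 + rot ω) = 1 := by
    have := h.eq₁ 0
    have := h.eq₂ 0
    have := hFm
    rw [hF] at this ⊢
    linear_combination z₂ 0 * h.eq₁ 0 - z₁ 0 * h.eq₂ 0 - this
  have c1 : ∀ᶠ θ in 𝓝 (0 : Torus), F (θ - rot ω) < 0 :=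
    (F.continuous.comp (continuous_id.sub continuous_const)).continuousAt.eventually
      (gt_mem_nhds (by change F (0 - rot ω) < 0; rw [hFm]; norm_num))
  have c2 : ∀ᶠ θ in 𝓝 (0 : Torus), 0 < F (θ + rot ω) :=
    (F.continuous.comp (continuous_id.add continuous_const)).continuousAt.eventually
      (lt_mem_nhds (by change 0 < F (0 + rot ω); rw [hFp]; norm_num))
  obtain ⟨n, hn1, hn2⟩ := exists_nsmul_mem_nhds_zero (rot ω) (c1.and c2)
  refine ⟨site F ω 0, hjop, ?_, ?_, n, ?_, ?_⟩
  · rw [site_eq, zero_zsmul, add_zero, hF0]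
  · have := site_add_one F ω 0 0
    rwa [zero_zsmul, add_zero, zero_add, hFp] at this
  · rw [show (n : ℤ) + 1 = ((n + 2 : ℕ) : ℤ) - 1 by push_cast; ring, site_sub_one, add_zero]
    exact hn1
  · rw [show (n : ℤ) + 3 = ((n + 2 : ℕ) : ℤ) + 1 by push_cast; ring, site_add_one, add_zero]
    exact hn2

theorem IsFloquetPair.exists_jform_pos (h : IsFloquetPair V ω a z₁ z₂) :
    ∃ x : ℤ →₀ ℝ, 0 < jform (fun i => site V ω 0 i - a) x := by
  by_contra! hcon
  obtain ⟨y, hy, h0, h1, n, hn, -⟩ := h.exists_recurrent_solution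
  linarith [pos_of_jform_nonpos hcon hy h0 h1 n]

/-- The involution `x n ↦ (-1) ^ n * x n` on finitely supported sequences. -/
def alternate (x : ℤ →₀ ℝ) : ℤ →₀ ℝ :=
  Finsupp.onFinset x.support (fun n => (-1 : ℝ) ^ n * x n) fun n hn => by
    rw [Finsupp.mem_support_iff]
    exact right_ne_zero_of_mul hn

theorem jop_neg_alternate (v x : ℤ → ℝ) (n : ℤ) :
    jop (fun i => -v i) (fun i => (-1 : ℝ) ^ i * x i) n = -((-1 : ℝ) ^ n * jop v x n) := by
  have h1 : (-1 : ℝ) ^ (n + 1) = -(-1 : ℝ) ^ n := by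
    rw [zpow_add_one₀ (by norm_num)]; ring
  have h2 : (-1 : ℝ) ^ (n - 1) = -(-1 : ℝ) ^ n := by
    rw [zpow_sub_one₀ (by norm_num)]; norm_num
  simp only [jop]
  rw [h1, h2]
  ring

theorem neg_one_zpow_mul_self (n : ℤ) : (-1 : ℝ) ^ n * (-1 : ℝ) ^ n = 1 := by
  rw [← mul_zpow]
  norm_num

theorem jform_neg_alternate (v : ℤ → ℝ) (x : ℤ →₀ ℝ) :
    jform (fun i => -v i) (alternate x) = -jform v x := by
  have h1 : jform (fun i => -v i) (alternate x) =
      ∑ i ∈ x.support, alternate x i * jop (fun i => -v i) (alternate x) i := by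
    refine Finset.sum_subset Finsupp.support_onFinset_subset fun i _ hi => ?_
    rw [Finsupp.notMem_support_iff] at hi
    rw [hi, zero_mul]
  rw [h1, jform, ← Finset.sum_neg_distrib]
  refine Finset.sum_congr rfl fun i _ => ?_
  have h2 : ⇑(alternate x) = fun i => (-1 : ℝ) ^ i * x i := rfl
  rw [h2, jop_neg_alternate]
  linear_combination (-(x i * jop v x i)) * neg_one_zpow_mul_self i

/-- Alternating signs reverses the form. The alternated solution would have to stay positive, yet y
has opposite signs at n + 1 and n + 3, sites of equal parity. -/
theorem IsFloquetPair.exists_jform_neg (h : IsFloquetPair V ω a z₁ z₂) :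
    ∃ x : ℤ →₀ ℝ, jform (fun i => site V ω 0 i - a) x < 0 := by
  by_contra! hcon
  obtain ⟨y, hy, h0, h1, n, hn, hn'⟩ := h.exists_recurrent_solution
  have hpos := pos_of_jform_nonpos (v := fun i => -(site V ω 0 i - a))
    (y := fun i => (-1 : ℝ) ^ i * -y i) (fun x => by
      have e := jform_neg_alternate (fun i => -(site V ω 0 i - a)) x
      simp only [neg_neg] at e
      have := hcon (alternate x)
      linarith) (fun n => by
      rw [jop_neg_alternate]
      have : jop (fun i => site V ω 0 i - a) (fun i => -y i) n =
          -jop (fun i => site V ω 0 i - a) y n := by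
        simp only [jop]; ring
      rw [this, hy]
      simp) (by simp [h0]) (by simp [h1])
  have p1 := hpos n
  have p2 := hpos (n + 2)
  have e : (-1 : ℝ) ^ (((n + 2 : ℕ) : ℤ) + 1) = (-1 : ℝ) ^ ((n : ℤ) + 1) := by
    rw [show ((n + 2 : ℕ) : ℤ) + 1 = ((n : ℤ) + 1) + 2 by push_cast; ring,
      zpow_add₀ (by norm_num)]
    norm_num
  beta_reduce at p1 p2
  rw [e, show ((n + 2 : ℕ) : ℤ) + 1 = (n : ℤ) + 3 by push_cast; ring] at p2
  nlinarith [mul_pos p1 p2, neg_one_zpow_mul_self ((n : ℤ) + 1), mul_pos hn' (neg_pos.2 hn)]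

theorem continuous_jform_path (V U : C(Torus, ℝ)) (ω a μ : ℝ) (x : ℤ →₀ ℝ) :
    Continuous fun s : ℝ => jform (fun i => site (V + s • U) ω 0 i - (a + s * μ)) x := by
  simp only [jform, jop, site_add_smul]
  fun_prop

/-- A hyperbolic first order perturbation opens a gap. -/
theorem IsFloquetPair.exists_gap (h : IsFloquetPair V ω a z₁ z₂) (hω : IsDiophantine ω)
    (hz : avg (z₁ * z₁) ≠ 0) {U : C(Torus, ℝ)}
    (hU : avg (U * (z₁ * z₂)) * avg (z₁ * z₁) ≠ avg (U * (z₁ * z₁)) * avg (z₁ * z₂))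
    {κ : ℝ} (hκ : HasIDS V ω a κ) :
    ∃ β₀ > (0 : ℝ), ∀ β ∈ Set.Ioo 0 β₀, ∃ l r : ℝ, IsOpenGap (V + β • U) ω l r ∧
      ∀ E ∈ Set.Ioo l r, HasIDS (V + β • U) ω E κ := by
  have hd := denseRange_zsmul_rot hω
  obtain ⟨μ, s₀, hs₀, hB⟩ := h.exists_boundedBelow_path (fun k hk => zsmul_rot_ne_zero hω hk) hz hU
  obtain ⟨x, hx⟩ := h.exists_jform_pos
  obtain ⟨x', hx'⟩ := h.exists_jform_neg
  -- The form at a fixed test vector is continuous in s, so both signs survive for small s.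
  have c := (continuous_jform_path V U ω a μ x).tendsto 0
  have c' := (continuous_jform_path V U ω a μ x').tendsto 0
  simp only [zero_smul, add_zero, zero_mul] at c c'
  obtain ⟨δ, hδ, hball⟩ := Metric.eventually_nhds_iff.1
    ((c.eventually (lt_mem_nhds hx)).and (c'.eventually (gt_mem_nhds hx')))
  refine ⟨min s₀ δ, lt_min hs₀ hδ, fun β hβ => ?_⟩
  have hβs : β ∈ Set.Ioo 0 s₀ := ⟨hβ.1, hβ.2.trans_le (min_le_left _ _)⟩
  obtain ⟨hpos, hneg⟩ := hball (y := β) (by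
    rw [Real.dist_eq, sub_zero, abs_of_pos hβ.1]
    exact hβ.2.trans_le (min_le_right _ _))
  obtain ⟨η, hη, hb⟩ := hB β hβs
  obtain ⟨l, r, hgap, hE⟩ := exists_isOpenGap hd
    (notMem_schrodingerSpectrum_of_boundedBelow hη hb) (exists_mem_spectrum_lt hneg)
    (exists_mem_spectrum_gt hpos)
  exact ⟨l, r, hgap, fun E hE' =>
    hasIDS_of_gap hd hgap hE hE' (hasIDS_of_path_tendsto hd V U a μ 0 hB hκ hβs)⟩

end


/-! ### Generic analytic potentials -/

section

open AnalyticPotential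

variable {ρ : ℝ} (hρ : 0 < ρ)

theorem AnalyticPotential.toPotential_add (W₁ W₂ : AnalyticPotential ρ) :
    toPotential hρ (W₁ + W₂) = toPotential hρ W₁ + toPotential hρ W₂ := by
  ext θ
  induction θ using QuotientAddGroup.induction_on
  rfl

theorem AnalyticPotential.toPotential_smul (c : ℝ) (W : AnalyticPotential ρ) :
    toPotential hρ (c • W) = c • toPotential hρ W := by
  ext θ
  induction θ using QuotientAddGroup.induction_on
  rename_i t
  change ((c • W).1 (realPoint hρ t)).re = c * (W.1 (realPoint hρ t)).re
  simp

theorem AnalyticPotential.abs_toPotential_le (W : AnalyticPotential ρ) (θ : Torus) :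
    |toPotential hρ W θ| ≤ ‖W‖ := by
  induction θ using QuotientAddGroup.induction_on
  rename_i t
  exact (Complex.abs_re_le_norm _).trans (W.1.norm_coe_le_norm _)

theorem abs_avg_le {F : C(Torus, ℝ)} {C : ℝ} (h : ∀ θ, |F θ| ≤ C) : |avg F| ≤ C := by
  have h' : ∀ θ, ‖F θ‖ ≤ C := h
  simpa [avg] using MeasureTheory.norm_integral_le_of_norm_le_const (Eventually.of_forall h')
    (μ := (AddCircle.haarAddCircle : MeasureTheory.Measure Torus))

/-- The continuous functional `W ↦ avg (W F)` on analytic potentials. -/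
def avgFunctional (F : C(Torus, ℝ)) : AnalyticPotential ρ →L[ℝ] ℝ :=
  LinearMap.mkContinuous
    { toFun := fun W => avg (toPotential hρ W * F)
      map_add' := fun W₁ W₂ => by
        rw [AnalyticPotential.toPotential_add, add_mul, avg_add]
      map_smul' := fun c W => by
        rw [AnalyticPotential.toPotential_smul, smul_mul_assoc, avg_smul]
        rfl } ‖F‖ (fun W => by
    refine abs_avg_le fun θ => ?_
    rw [ContinuousMap.mul_apply, abs_mul, mul_comm]
    exact mul_le_mul (F.norm_coe_le_norm θ) (abs_toPotential_le hρ W θ) (abs_nonneg _)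
      (norm_nonneg _))

theorem norm_cos_le {k : ℤ} {c : ℝ} {z : ℂ} (hz : z ∈ strip ρ) :
    ‖Complex.cos (k * z + c)‖ ≤ Real.exp (|(k : ℝ)| * ρ) := by
  have hz' : |z.im| < ρ := hz
  have hb : ∀ w : ℝ, |w| ≤ |(k : ℝ) * z.im| → Real.exp w ≤ Real.exp (|(k : ℝ)| * ρ) := by
    intro w hw
    refine Real.exp_le_exp.2 ((le_abs_self w).trans (hw.trans ?_))
    rw [abs_mul]
    exact mul_le_mul_of_nonneg_left hz'.le (abs_nonneg _)
  rw [Complex.cos, norm_div, Complex.norm_ofNat, div_le_iff₀ two_pos]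
  refine (norm_add_le _ _).trans ?_
  rw [Complex.norm_exp, Complex.norm_exp]
  have e1 : ((k * z + c) * Complex.I).re = -((k : ℝ) * z.im) := by simp
  have e2 : (-(k * z + c) * Complex.I).re = (k : ℝ) * z.im := by simp
  rw [e1, e2]
  linarith [hb _ (abs_neg ((k : ℝ) * z.im)).le, hb _ (le_refl |(k : ℝ) * z.im|)]

variable (ρ) in
/-- The potential `θ ↦ cos (kθ + c)`. -/
def cosPotential (k : ℤ) (c : ℝ) : AnalyticPotential ρ :=
  ⟨BoundedContinuousFunction.ofNormedAddCommGroup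
    (fun z : strip ρ => Complex.cos (k * z + c))
    (by fun_prop) (Real.exp (|(k : ℝ)| * ρ)) fun z => norm_cos_le z.2, by
    refine ⟨⟨fun z => Complex.cos (k * z + c), by fun_prop, fun _ => rfl⟩, ?_, ?_⟩
    · intro z w h
      change Complex.cos (k * w + c) = Complex.cos (k * z + c)
      rw [h, show (k : ℂ) * (z + 2 * Real.pi) + c = k * z + c + k * (2 * Real.pi) by ring,
        Complex.cos_add_int_mul_two_pi]
    · intro z h
      change (Complex.cos (k * z + c)).im = 0
      have e : (k : ℂ) * z + c = ((k * (z : ℂ).re + c : ℝ) : ℂ) := by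
        apply Complex.ext <;> simp [h]
      rw [e, ← Complex.ofReal_cos, Complex.ofReal_im]⟩

theorem cosPotential_coe (k : ℤ) (c t : ℝ) :
    toPotential hρ (cosPotential ρ k c) (t : Torus) = Real.cos (k * t + c) := by
  change (Complex.cos (k * (t : ℂ) + c)).re = _
  rw [show (k : ℂ) * t + c = ((k * t + c : ℝ) : ℂ) by push_cast; ring, ← Complex.ofReal_cos,
    Complex.ofReal_re]

theorem fourier_eq_cosPotential (n : ℤ) (θ : Torus) : fourier n θ =
    (toPotential hρ (cosPotential ρ n 0) θ : ℂ) -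
      (toPotential hρ (cosPotential ρ n (Real.pi / 2)) θ : ℂ) * Complex.I := by
  induction θ using QuotientAddGroup.induction_on
  rename_i t
  rw [cosPotential_coe, cosPotential_coe, fourier_coe_apply, Real.cos_add_pi_div_two, add_zero]
  have hpi : (Real.pi : ℂ) ≠ 0 := by exact_mod_cast Real.pi_ne_zero
  have e : 2 * (Real.pi : ℂ) * Complex.I * n * t / ((2 * Real.pi : ℝ) : ℂ) =
      ((n * t : ℝ) : ℂ) * Complex.I := by
    push_cast
    field_simp
  rw [e, Complex.exp_mul_I]
  push_cast
  ring

theorem integrable_ofReal_haar (H : C(Torus, ℝ)) : MeasureTheory.Integrable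
    (fun θ => (H θ : ℂ)) (AddCircle.haarAddCircle : MeasureTheory.Measure Torus) :=
  integrable_haar ⟨fun θ => (H θ : ℂ), Complex.continuous_ofReal.comp H.continuous⟩

/-- Cosines with arbitrary phase belong to the space for every ρ; if the functional vanished on
them, all Fourier coefficients of F would be zero. -/
theorem avgFunctional_ne_zero {F : C(Torus, ℝ)} (hF : F ≠ 0) :
    ∃ W : AnalyticPotential ρ, avgFunctional hρ F W ≠ 0 := by
  by_contra! hcon
  apply hF
  let G : C(Torus, ℂ) := ⟨fun θ => (F θ : ℂ), Complex.continuous_ofReal.comp F.continuous⟩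
  have hcoef : ∀ n, fourierCoeff G n = 0 := by
    intro n
    obtain ⟨H₁, H₂, e, z₁, z₂⟩ : ∃ H₁ H₂ : C(Torus, ℝ),
        (∀ θ : Torus, fourier (-n) θ • G θ = (H₁ θ : ℂ) - (H₂ θ : ℂ) * Complex.I) ∧
          avg H₁ = 0 ∧ avg H₂ = 0 := by
      refine ⟨toPotential hρ (cosPotential ρ (-n) 0) * F,
        toPotential hρ (cosPotential ρ (-n) (Real.pi / 2)) * F, fun θ => ?_, hcon _, hcon _⟩
      rw [fourier_eq_cosPotential hρ]
      simp only [G, ContinuousMap.coe_mk, ContinuousMap.mul_apply, smul_eq_mul]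
      push_cast
      ring
    rw [fourierCoeff, MeasureTheory.integral_congr_ae (Eventually.of_forall e),
      MeasureTheory.integral_sub (integrable_ofReal_haar H₁)
        ((integrable_ofReal_haar H₂).mul_const _), MeasureTheory.integral_mul_const,
      integral_complex_ofReal, integral_complex_ofReal]
    change ((avg H₁ : ℝ) : ℂ) - ((avg H₂ : ℝ) : ℂ) * Complex.I = 0
    simp [z₁, z₂]
  have hs : Summable (fourierCoeff G) := by
    rw [show fourierCoeff G = fun _ => 0 from funext hcoef]
    exact summable_zero
  ext θ
  have h1 := has_pointwise_sum_fourier_series_of_summable hs θ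
  simp only [hcoef, zero_smul] at h1
  have h2 : G θ = 0 := h1.unique hasSum_zero
  exact_mod_cast (show ((F θ : ℝ) : ℂ) = 0 from h2)

end

theorem isOpen_dense_ne_zero {E : Type*} [NormedAddCommGroup E] [NormedSpace ℝ E]
    (f : E →L[ℝ] ℝ) (hf : ∃ x, f x ≠ 0) : IsOpen {x | f x ≠ 0} ∧ Dense {x | f x ≠ 0} := by
  refine ⟨isOpen_ne.preimage f.continuous, ?_⟩
  obtain ⟨w, hw⟩ := hf
  intro x
  by_cases hx : f x = 0
  · have h1 : Tendsto (fun t : ℝ => x + t • w) (𝓝[≠] 0) (𝓝 (x + (0 : ℝ) • w)) :=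
      ((by fun_prop : Continuous fun t : ℝ => x + t • w).tendsto 0).mono_left nhdsWithin_le_nhds
    rw [zero_smul, add_zero] at h1
    refine mem_closure_of_tendsto h1 ?_
    filter_upwards [self_mem_nhdsWithin] with t ht
    simp only [map_add, map_smul, hx, zero_add, smul_eq_mul]
    exact mul_ne_zero ht hw
  · exact subset_closure hx

section

variable {V z₁ z₂ : C(Torus, ℝ)} {ω a : ℝ}

theorem IsFloquetPair.ne_zero (h : IsFloquetPair V ω a z₁ z₂) : z₁ ≠ 0 := by
  rintro rfl
  simpa using h.wronskian 0

/-- The density factors as z₁(A z₂ - B z₁). Analytic functions on the line have no zero divisors, so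
one factor would vanish identically; either case contradicts the Wronskian, as A > 0. -/
theorem IsFloquetPair.density_ne_zero (h : IsFloquetPair V ω a z₁ z₂) (h₁ : IsRealAnalytic z₁)
    (h₂ : IsRealAnalytic z₂) : avg (z₁ * z₁) • (z₁ * z₂) - avg (z₁ * z₂) • (z₁ * z₁) ≠ 0 := by
  intro h0
  have hA := avg_sq_pos h.ne_zero
  set A := avg (z₁ * z₁)
  set B := avg (z₁ * z₂)
  have hmul : ∀ t ∈ (Set.univ : Set ℝ),
      z₁ (t : Torus) * (A * z₂ (t : Torus) - B * z₁ (t : Torus)) = 0 := by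
    intro t _
    have := DFunLike.congr_fun h0 (t : Torus)
    simp only [ContinuousMap.sub_apply, ContinuousMap.smul_apply, ContinuousMap.mul_apply,
      smul_eq_mul, ContinuousMap.zero_apply] at this
    linarith
  have han : AnalyticOnNhd ℝ (fun t : ℝ => A * z₂ (t : Torus) - B * z₁ (t : Torus)) Set.univ :=
    (analyticOnNhd_const.mul h₂).sub (analyticOnNhd_const.mul h₁)
  rcases AnalyticOnNhd.eq_zero_or_eq_zero_of_mul_eq_zero h₁ han hmul isPreconnected_univ with
    hz | hz
  · apply h.ne_zero
    ext θ
    induction θ using QuotientAddGroup.induction_on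
    exact hz _ (Set.mem_univ _)
  · have hz' : ∀ θ : Torus, A * z₂ θ = B * z₁ θ := by
      intro θ
      induction θ using QuotientAddGroup.induction_on
      exact sub_eq_zero.1 (hz _ (Set.mem_univ _))
    have hw := h.wronskian 0
    have : A * (z₁ 0 * z₂ (0 - rot ω) - z₂ 0 * z₁ (0 - rot ω)) = 0 := by
      linear_combination z₁ 0 * hz' (0 - rot ω) - z₁ (0 - rot ω) * hz' 0
    rw [hw, mul_one] at this
    exact hA.ne' this

theorem avg_mul_density (U z₁ z₂ : C(Torus, ℝ)) (A B : ℝ) :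
    avg (U * (A • (z₁ * z₂) - B • (z₁ * z₁))) =
      A * avg (U * (z₁ * z₂)) - B * avg (U * (z₁ * z₁)) := by
  rw [mul_sub, avg_sub, mul_smul_comm, mul_smul_comm, avg_smul, avg_smul]

end

end

end QPSchrodinger

open QPSchrodinger
theorem mainTheorem7 (V : C(Torus, ℝ)) (hV : IsRealAnalytic V) (ω : ℝ) (hω : IsDiophantine ω)
    (a : ℝ) (hred : AnalyticallyReducibleTo (cocycle a V) ω 1) :
    ∃ κ : ℝ, HasIDS V ω a κ ∧
      ∀ (ρ : ℝ) (hρ : 0 < ρ),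
        ∃ G : Set (AnalyticPotential ρ), IsOpen G ∧ Dense G ∧
          ∀ W ∈ G, ∃ β₀ > (0 : ℝ), ∀ β : ℝ, β ≠ 0 → |β| < β₀ →
            ∃ l r : ℝ, IsOpenGap (V + β • AnalyticPotential.toPotential hρ W) ω l r ∧
              ∀ E ∈ Set.Ioo l r,
                HasIDS (V + β • AnalyticPotential.toPotential hρ W) ω E κ := by
  obtain ⟨κ, hκ⟩ := exists_hasIDS (denseRange_zsmul_rot hω) V a
  obtain ⟨z₁, z₂, h₁, h₂, hz⟩ := exists_isFloquetPair hred
  refine ⟨κ, hκ, fun ρ hρ => ?_⟩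
  -- The mean of W against F is, up to sign and the positive factor `avg (z₁ * z₁)`, the diagonal
  -- entry p of the averaged system.
  set F := avg (z₁ * z₁) • (z₁ * z₂) - avg (z₁ * z₂) • (z₁ * z₁) with hF
  obtain ⟨hopen, hdense⟩ := isOpen_dense_ne_zero (avgFunctional hρ F)
    (avgFunctional_ne_zero hρ (hz.density_ne_zero h₁ h₂))
  refine ⟨_, hopen, hdense, fun W hW => ?_⟩
  set U := AnalyticPotential.toPotential hρ W with hU
  have hne : avg (z₁ * z₁) * avg (U * (z₁ * z₂)) - avg (z₁ * z₂) * avg (U * (z₁ * z₁)) ≠ 0 := by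
    rw [← avg_mul_density]
    exact hW
  have hneg : ∀ f : C(Torus, ℝ), avg (-U * f) = -avg (U * f) := fun f => by
    rw [show -U * f = (-1 : ℝ) • (U * f) by rw [neg_one_smul, neg_mul], avg_smul, neg_one_mul]
  have hA := (avg_sq_pos hz.ne_zero).ne'
  obtain ⟨β₁, hβ₁, H₁⟩ := hz.exists_gap hω hA (U := U)
    (fun h => hne (by linear_combination h)) hκ
  -- Negative β is the case of -β > 0 and -U, for which the nondegeneracy condition only changes
  -- sign.
  obtain ⟨β₂, hβ₂, H₂⟩ := hz.exists_gap hω hA (U := -U)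
    (fun h => hne (by rw [hneg, hneg] at h; linear_combination -h)) hκ
  refine ⟨min β₁ β₂, lt_min hβ₁ hβ₂, fun β hβ hlt => ?_⟩
  rcases lt_or_gt_of_ne hβ with hβ | hβ
  · rw [abs_of_neg hβ] at hlt
    have := H₂ (-β) ⟨by linarith, hlt.trans_le (min_le_right _ _)⟩
    rwa [neg_smul_neg] at this
  · rw [abs_of_pos hβ] at hlt
    exact H₁ β ⟨hβ, hlt.trans_le (min_le_left _ _)⟩
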